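/- **Proposition 5.14.** Let $k$ be a field of characteristic $0$ and let $N\ge 1$. *Matrix case.* Let $u_N$ be an invertible $m\times m$ matrix over $k$ that is diagonalizable over $k$, and let $L=\sum_{i\le N}u_i\partial^i$, $\partial=d/dx$, be the generic matrix differential operator ($0\le i\le N$), or the generic matrix pseudodifferential operator ($-\infty<i\le N$), with highest coefficient $u_N$ and with $u_{N-1}\in\operatorname{Im}\operatorname{ad}(u_N)$. That is, the entries of the $u_i$, $i\le N-2$, together with the coordinates of $u_{N-1}$ in a basis of $\operatorname{Im}\operatorname{ad}(u_N)\subset \mathrm{Mat}_m(k)$, are independent differential variables. Let $C_u$ be the $k$-algebra of differential polynomials in these variables, and $C_{u,\varphi}$ the $k$-algebra of differential polynomials in these variables and in the further independent variables $\varphi=(\varphi_1,\dots,\varphi_m)^t$. Let $Z^c(L)$ be the center of the centralizer of $L$ in the algebra of matrix pseudodifferential operators $\sum_{i\le n}a_i\partial^i$ ($n\in\mathbb Z$, $a_i\in\mathrm{Mat}_m(C_u)$). *Difference case.* Let $L=\triangle^N+\sum_{i<N}u_i\triangle^i$ be the generic scalar difference operator: the $u_i$, $i<N$, are independent variables and $\triangle$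 is the shift. Let $C_u$ and $C_{u,\varphi}$ be the $k$-algebras of polynomials in all the shifts $\triangle^s u_i$, respectively in all the shifts $\triangle^su_i$ and $\triangle^s\varphi$, $s\in\mathbb Z$, where $\varphi$ is one more independent variable. Let $Z^c(L)$ be the center of the centralizer of $L$ in the algebra of difference operators $\sum_{i\le n}a_i\triangle^i$ ($n\in\mathbb Z$, $a_i\in C_u$); it contains all $P=L^r$, $r\in\mathbb N$. In both cases let $P_+$ denote the part of $P$ with nonnegative powers of $\partial$ (respectively $\triangle$). Then for every $P\in Z^c(L)$ there is exactly one evolution derivation $X_P^{\rm ext}$ of $C_{u,\varphi}$ (a $k$-linear derivation commuting with $\partial$, respectively with $\triangle$) with $$X_P^{\rm ext}(L)=[P_+,L],\qquad X_P^{\rm ext}(\varphi)=P_+(\varphi),$$ where $X_P^{\rm ext}$ is applied to $L$ coefficient by coefficient and to $\varphi$ component by component. All these extended Lax flows commute: $$[X_P^{\rm ext},X_Q^{\rm ext}]=0\qquad\text{for all }P,Q\in Z^c(L).$$ -/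

import Mathlib

noncomputable section

namespace LaxExt

open MvPolynomial

/-! Formal operators and their multiplication -/

/-- A formal series `∑_{i ≤ n} a_i ξ^i` in one symbol `ξ` (which will be `∂` or the shift `△`),
with coefficients in `R` written on the left and with exponents bounded above. -/
@[ext] structure FormalOp (R : Type*) [Zero R] where
  coeff : ℤ → R
  bddAbove : ∃ n : ℤ, ∀ i, n < i → coeff i = 0

/-- Composition of formal operators, when the symbol `ξ` is moved past coefficients by the rule
`ξ^i ∘ a = ∑_{j ≥ 0} (D i j a) ξ^{i-j}`. As exponents are bounded above, only finitely many
terms of each of the sums below are nonzero. -/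
def FormalOp.mul {R : Type*} [NonUnitalNonAssocSemiring R] (D : ℤ → ℕ → R →+ R)
    (A B : FormalOp R) : FormalOp R where
  coeff n := ∑ᶠ p : ℤ × ℕ, A.coeff p.1 * D p.1 p.2 (B.coeff (n - p.1 + p.2))
  bddAbove := by
    obtain ⟨a, ha⟩ := A.bddAbove
    obtain ⟨b, hb⟩ := B.bddAbove
    refine ⟨a + b, fun n hn => ?_⟩
    rw [← finsum_zero (α := ℤ × ℕ)]
    refine finsum_congr fun p => ?_
    by_cases h : a < p.1
    · rw [ha _ h, zero_mul]
    · rw [hb _ (by omega), map_zero, mul_zero]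

/-- The difference of two formal operators. -/
def FormalOp.sub {R : Type*} [AddGroup R] (A B : FormalOp R) : FormalOp R where
  coeff n := A.coeff n - B.coeff n
  bddAbove := by
    obtain ⟨a, ha⟩ := A.bddAbove
    obtain ⟨b, hb⟩ := B.bddAbove
    exact ⟨max a b, fun n hn => by
      rw [ha n (lt_of_le_of_lt (le_max_left a b) hn),
        hb n (lt_of_le_of_lt (le_max_right a b) hn), sub_zero]⟩

/-- The commutator `[A, B] = A ∘ B - B ∘ A`. -/
def FormalOp.comm {R : Type*} [NonUnitalNonAssocRing R] (D : ℤ → ℕ → R →+ R)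
    (A B : FormalOp R) : FormalOp R :=
  (FormalOp.mul D A B).sub (FormalOp.mul D B A)

/-- The part `A_+` of `A` with nonnegative exponents. -/
def FormalOp.plus {R : Type*} [Zero R] (A : FormalOp R) : FormalOp R where
  coeff n := if 0 ≤ n then A.coeff n else 0
  bddAbove := by
    obtain ⟨a, ha⟩ := A.bddAbove
    exact ⟨a, fun n hn => by simp [ha n hn]⟩

/-- The centralizer `Z(L)`: all formal operators that commute with `L`. -/
def centralizer {R : Type*} [NonUnitalNonAssocRing R] (D : ℤ → ℕ → R →+ R)
    (L : FormalOp R) : Set (FormalOp R) :=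
  {P | FormalOp.mul D P L = FormalOp.mul D L P}

/-- `Z^c(L)`: the center of the centralizer of `L`. -/
def centerOfCentralizer {R : Type*} [NonUnitalNonAssocRing R] (D : ℤ → ℕ → R →+ R)
    (L : FormalOp R) : Set (FormalOp R) :=
  {P | P ∈ centralizer D L ∧
    ∀ S ∈ centralizer D L, FormalOp.mul D P S = FormalOp.mul D S P}

/-! Differential polynomials and matrix pseudodifferential operators -/

/-- Differential polynomials over `k` in the dependent variables `v ∈ V`:
the variable `(v, j)` is the `j`-th `x`-derivative `v^{(j)}`. -/
abbrev DiffPoly (k V : Type*) [CommSemiring k] := MvPolynomial (V × ℕ) k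

/-- The derivation `∂ = d/dx` of differential polynomials, `∂ (v^{(j)}) = v^{(j+1)}`. -/
def totalDeriv (k V : Type*) [CommSemiring k] : Derivation k (DiffPoly k V) (DiffPoly k V) :=
  mkDerivation k fun p => X (p.1, p.2 + 1)

/-- The rule `∂^i ∘ a = ∑_j binom(i, j) a^{(j)} ∂^{i-j}` for matrices `a` of differential
polynomials (`i` may be negative; the derivatives are taken entrywise). -/
def diffRule (k V : Type*) [CommRing k] (m : ℕ) (i : ℤ) (j : ℕ) :
    Matrix (Fin m) (Fin m) (DiffPoly k V) →+ Matrix (Fin m) (Fin m) (DiffPoly k V) :=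
  Ring.choose i j •
    (AddMonoidHom.mapMatrix
      (((totalDeriv k V : Module.End k (DiffPoly k V)) ^ j).toAddMonoidHom))

/-- The image of `ad a = [a, ·]` in the space of constant matrices. -/
abbrev imAd {k : Type*} [CommRing k] {m : ℕ} (a : Matrix (Fin m) (Fin m) k) :
    Submodule k (Matrix (Fin m) (Fin m) k) :=
  LinearMap.range (LinearMap.mulLeft k a - LinearMap.mulRight k a)

/-- A constant matrix that is diagonalizable over `k`. -/
def IsDiagonalizable {k : Type*} [CommRing k] {m : ℕ} (a : Matrix (Fin m) (Fin m) k) : Prop :=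
  ∃ (S : (Matrix (Fin m) (Fin m) k)ˣ) (c : Fin m → k),
    a = (S : Matrix (Fin m) (Fin m) k) * Matrix.diagonal c * (S⁻¹ : (Matrix (Fin m) (Fin m) k)ˣ)

/-- The dependent variables of the generic matrix Lax operator of order `N` with exponents in `I`:
all entries of the matrices `u_i`, `i ∈ I`, `i ≤ N - 2`, and the `d` coordinates of `u_{N-1}` in a
basis of `Im ad u_N`. -/
abbrev LaxVar (m N d : ℕ) (I : Set ℤ) : Type :=
  ({i : ℤ // i ∈ I ∧ i ≤ (N : ℤ) - 2} × Fin m × Fin m) ⊕ Fin d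

open Classical in
/-- The generic Lax operator `L = ∑_{i ∈ I, i ≤ N} u_i ∂^i`, where `u_N = a` is constant, `u_{N-1}`
is the generic element of `Im ad a` and all other entries are independent variables. -/
def matrixLax {k : Type*} [CommRing k] {m d : ℕ} (N : ℕ) (I : Set ℤ)
    (a : Matrix (Fin m) (Fin m) k) (b : Module.Basis (Fin d) k (imAd a)) :
    FormalOp (Matrix (Fin m) (Fin m) (DiffPoly k (LaxVar m N d I))) where
  coeff i :=
    if i = N then a.map C
    else if i = (N : ℤ) - 1 then
      ∑ s : Fin d, (X (Sum.inr s, 0) : DiffPoly k (LaxVar m N d I)) •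
        (b s : Matrix (Fin m) (Fin m) k).map C
    else if h : i ∈ I ∧ i ≤ (N : ℤ) - 2 then
      Matrix.of fun α β => X (Sum.inl (⟨i, h⟩, α, β), 0)
    else 0
  bddAbove := ⟨N, fun i hi => by
    rw [if_neg (by omega), if_neg (by omega), dif_neg (by rintro ⟨-, h⟩; omega)]⟩

/-- The inclusion of the differential polynomials in `u` into those in `u` and
`φ = (φ_1, …, φ_m)`. -/
def diffIncl (k V : Type*) [CommSemiring k] (m : ℕ) : DiffPoly k V →ₐ[k] DiffPoly k (V ⊕ Fin m) :=
  rename fun p => (Sum.inl p.1, p.2)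

/-- The vector `A(φ) = ∑_{i ≥ 0} a_i φ^{(i)}`, for a matrix differential operator
`A = ∑_{i ≥ 0} a_i ∂^i` whose coefficients depend on `u` only. -/
def diffApply {k V : Type*} [CommRing k] {m : ℕ}
    (A : FormalOp (Matrix (Fin m) (Fin m) (DiffPoly k V))) (α : Fin m) :
    DiffPoly k (V ⊕ Fin m) :=
  ∑ᶠ i : ℕ, ∑ β : Fin m, diffIncl k V m (A.coeff i α β) * X (Sum.inr β, i)

/-- `Y` is the extended flow `L_t = [P_+, L]`, `φ_t = P_+(φ)`: an evolution derivation (a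
`k`-derivation that commutes with `∂`) of the differential polynomials in `u` and `φ`. -/
structure IsExtMatrixLaxFlow {k V : Type*} [CommRing k] {m : ℕ}
    (L P : FormalOp (Matrix (Fin m) (Fin m) (DiffPoly k V)))
    (Y : Derivation k (DiffPoly k (V ⊕ Fin m)) (DiffPoly k (V ⊕ Fin m))) : Prop where
  evolution : ∀ f, Y (totalDeriv k (V ⊕ Fin m) f) = totalDeriv k (V ⊕ Fin m) (Y f)
  lax : ∀ (i : ℤ) (α β : Fin m), Y (diffIncl k V m (L.coeff i α β)) =
    diffIncl k V m ((FormalOp.comm (diffRule k V m) P.plus L).coeff i α β)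
  ext : ∀ α : Fin m, Y (X (Sum.inr α, 0)) = diffApply P.plus α

/-! Difference polynomials and scalar difference operators -/

/-- Difference polynomials over `k` in the dependent variables `v ∈ V`:
the variable `(v, s)` is the shifted variable `△^s v`. -/
abbrev ShiftPoly (k V : Type*) [CommSemiring k] := MvPolynomial (V × ℤ) k

/-- The automorphism `△^i` of difference polynomials, `△^i (△^s v) = △^{s+i} v`. -/
def shift (k V : Type*) [CommSemiring k] (i : ℤ) : ShiftPoly k V →ₐ[k] ShiftPoly k V :=
  rename fun p => (p.1, p.2 + i)

/-- The rule `△^i ∘ a = △^i(a) △^i`. -/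
def shiftRule (k V : Type*) [CommRing k] (i : ℤ) (j : ℕ) : ShiftPoly k V →+ ShiftPoly k V :=
  if j = 0 then (shift k V i : ShiftPoly k V →+ ShiftPoly k V) else 0

/-- The generic scalar Lax operator `L = △^N + ∑_{i < N} u_i △^i`. -/
def shiftLax (k : Type*) [CommRing k] (N : ℕ) :
    FormalOp (ShiftPoly k {i : ℤ // i < N}) where
  coeff i := if h : i < N then X (⟨i, h⟩, 0) else if i = N then 1 else 0
  bddAbove := ⟨N, fun i hi => by rw [dif_neg (by omega), if_neg (by omega)]⟩

/-- The inclusion of the difference polynomials in `u` into those in `u` and a scalar `φ`. -/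
def shiftIncl (k V : Type*) [CommSemiring k] : ShiftPoly k V →ₐ[k] ShiftPoly k (V ⊕ Unit) :=
  rename fun p => (Sum.inl p.1, p.2)

/-- `A(φ) = ∑_{i ≥ 0} a_i △^i(φ)`, for an operator `A = ∑_{i ≥ 0} a_i △^i`. -/
def shiftApply {k V : Type*} [CommRing k] (A : FormalOp (ShiftPoly k V)) :
    ShiftPoly k (V ⊕ Unit) :=
  ∑ᶠ i : ℕ, shiftIncl k V (A.coeff i) * X (Sum.inr (), (i : ℤ))

/-- `Y` is the extended flow `L_t = [P_+, L]`, `φ_t = P_+(φ)`: an evolution derivation (a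
`k`-derivation that commutes with `△`) of the difference polynomials in `u` and `φ`. -/
structure IsExtShiftLaxFlow {k V : Type*} [CommRing k] (L P : FormalOp (ShiftPoly k V))
    (Y : Derivation k (ShiftPoly k (V ⊕ Unit)) (ShiftPoly k (V ⊕ Unit))) : Prop where
  evolution : ∀ f, Y (shift k (V ⊕ Unit) 1 f) = shift k (V ⊕ Unit) 1 (Y f)
  lax : ∀ i : ℤ, Y (shiftIncl k V (L.coeff i)) =
    shiftIncl k V ((FormalOp.comm (shiftRule k V) P.plus L).coeff i)
  ext : Y (X (Sum.inr (), 0)) = shiftApply P.plus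

end LaxExt

end

noncomputable section
set_option autoImplicit false

namespace LaxExt

open MvPolynomial

/-! Summation lemmas -/

/-! Write $\delta_P$ for the flow of $P$ on polynomials in $u$ and $P_-=P-P_+$. Everything rests on
one claim: the Lax equation $\delta_P L=[P_+,L]$ forces $\delta_P Q=[P_+,Q]$ for every $Q\in Z^c(L)$
(`IsLaxSystem.flow_eq`). Applying $\delta_P$ to $[Q,L]=0$ and using the Jacobi identity shows that
$\delta_PQ-[P_+,Q]$ commutes with $L$. Its coefficients vanish at $u=0$, and an operator that
commutes with $L$ and vanishes at $u=0$ is zero.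

The claim gives $\delta_PQ_+-\delta_QP_+=([P_+,Q]-[Q_+,P])_+=[P_+,Q_+]$, since $[P,Q]=0$ and
$[P_-,Q_-]$ has only negative exponents (`IsLaxSystem.zero_curvature`). Applied to $[Q_+,L]-[P_+,L]$
through the Leibniz rule it shows that the flows commute on $L$; applied to $\varphi$ it shows that
they commute on $\varphi$. A commutator of evolution derivations is again one, so these generators
suffice.

The two cases differ only in the facts collected in `IsLaxSystem`. For the rigidity at $u=0$, the
top coefficient $q$ of an operator commuting with $L$ turns out to be constant, hence equal to its
value at $u=0$. In the difference case $\triangle^Nq=q$. In the matrix case $q$ commutes with $u_N$,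
and the next coefficient shows that $Nu_N\partial q$ lies in both the kernel and the image of
$\operatorname{ad}u_N$. These meet trivially because $u_N$ is diagonalizable, so $\partial q=0$
(`matrixLaxOp_eq_zero`).

That $[P_+,Q]$ vanishes at $u=0$ requires the constant matrices $P_i|_{u=0}$ and $Q_j|_{u=0}$ to
commute. Give $u_i^{(j)}$ the weight $N-i+j$ and $\partial$ the weight $1$. Then $L$ is homogeneous,
so the weight derivation $T$ preserves $Z^c(L)$. The relations $[T^tP,Q]=0$ at $u=0$ read $\sum_i
i^t[P_i,Q_{n-i}]=0$ for all $t$, and a Vandermonde argument separates the summands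
(`OpAlg.IsCentral.map_coeff_commute`).

Existence of the flow comes from $[P_+,L]=[L,P_-]$: its order is at most $N-1$, and in the matrix
case its coefficient there lies in the image of $\operatorname{ad}u_N$, so the right side has the
shape of a variation of $L$. -/

lemma sum_range_shift {M : Type*} [AddCommMonoid M] (g : ℕ → M) (s K : ℕ)
    (h1 : ∀ y < s, g y = 0) (h2 : ∀ y, K ≤ y → g y = 0) :
    ∑ y ∈ Finset.range K, g y = ∑ z ∈ Finset.range K, g (s + z) := by
  have e1 : ∑ y ∈ Finset.range (s + K), g y = ∑ z ∈ Finset.range K, g (s + z) := by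
    rw [Finset.sum_range_add, Finset.sum_eq_zero (fun y hy => h1 y (Finset.mem_range.mp hy)),
      zero_add]
  have e2 : ∑ y ∈ Finset.range (K + s), g y = ∑ y ∈ Finset.range K, g y := by
    rw [Finset.sum_range_add, Finset.sum_eq_zero (s := Finset.range s)
      (fun y _ => h2 (K + y) (Nat.le_add_right _ _)), add_zero]
  rw [← e1, ← e2, add_comm]

lemma sum_range_range_eq_sum_antidiagonal {M : Type*} [AddCommMonoid M] (f : ℕ → ℕ → M) (K : ℕ)
    (h : ∀ j p, K ≤ j + p → f j p = 0) :
    ∑ j ∈ Finset.range K, ∑ p ∈ Finset.range K, f j p =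
      ∑ T ∈ Finset.range K, ∑ x ∈ Finset.HasAntidiagonal.antidiagonal T, f x.1 x.2 := by
  rw [← Finset.sum_product', Finset.sum_sigma']
  symm
  refine Finset.sum_of_injOn (fun s => s.2) ?_ ?_ ?_ ?_
  · rintro ⟨T, x⟩ hx ⟨T', x'⟩ hx' (e : x = x')
    subst e
    simp only [Finset.coe_sigma, Set.mem_sigma_iff, Finset.mem_coe, Finset.mem_range,
      Finset.HasAntidiagonal.mem_antidiagonal] at hx hx'
    obtain rfl : T = T' := by omega
    rfl
  · rintro ⟨T, x⟩ hx
    simp only [Finset.coe_sigma, Set.mem_sigma_iff, Finset.mem_coe, Finset.mem_range,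
      Finset.HasAntidiagonal.mem_antidiagonal, Finset.mem_product] at hx ⊢
    omega
  · rintro ⟨j, p⟩ - hx
    apply h
    by_contra hc
    exact hx ⟨⟨j + p, (j, p)⟩, by simpa using hc, rfl⟩
  · rintro ⟨T, x⟩ -
    rfl

/-! The algebra of formal operators -/

/-- The compatibility of the commutation rule with products, which makes composition of formal
operators associative. -/
structure IsAssocRule {R : Type*} [Ring R] (D : ℤ → ℕ → R →+ R) : Prop where
  assoc : ∀ (i l : ℤ) (T : ℕ) (b c : R),
    ∑ x ∈ Finset.HasAntidiagonal.antidiagonal T, D i x.1 b * D (i + l - x.1) x.2 c =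
      ∑ x ∈ Finset.HasAntidiagonal.antidiagonal T, D i x.1 (b * D l x.2 c)

/-- `A` has order at most `a`. -/
def FormalOp.OrderLE {R : Type*} [Zero R] (A : FormalOp R) (a : ℤ) : Prop :=
  ∀ i, a < i → A.coeff i = 0

/-- A nonzero term has $x+j\le a+b-n$, so any `K` above this bound truncates both sums. The freedom
in `K` lets several products share one range. -/
lemma FormalOp.mul_coeff {R : Type*} [NonUnitalNonAssocSemiring R] (D : ℤ → ℕ → R →+ R)
    {A B : FormalOp R} {a b : ℤ} (hA : A.OrderLE a) (hB : B.OrderLE b) (n : ℤ) {K : ℕ}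
    (hK : a + b - n < K) :
    (FormalOp.mul D A B).coeff n = ∑ x ∈ Finset.range K, ∑ j ∈ Finset.range K,
      A.coeff (a - x) * D (a - x) j (B.coeff (n - (a - x) + j)) := by
  rw [← Finset.sum_product']
  change ∑ᶠ p : ℤ × ℕ, _ = _
  have hz : ∀ p : ℤ × ℕ, (a < p.1 ∨ b < n - p.1 + p.2) →
      A.coeff p.1 * D p.1 p.2 (B.coeff (n - p.1 + p.2)) = 0 := by
    rintro p (h | h)
    · rw [hA _ h, zero_mul]
    · rw [hB _ h, map_zero, mul_zero]
  let e : ℕ × ℕ → ℤ × ℕ := fun q => (a - q.1, q.2)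
  have he : Function.Injective e := by
    rintro ⟨x, j⟩ ⟨y, l⟩ h
    simp only [e, Prod.mk.injEq] at h ⊢
    omega
  rw [finsum_eq_sum_of_support_subset (s := (Finset.range K ×ˢ Finset.range K).map ⟨e, he⟩)]
  · rw [Finset.sum_map]
    rfl
  · intro p hp
    have h : ¬ (a < p.1 ∨ b < n - p.1 + p.2) := fun h => hp (hz p h)
    simp only [Finset.coe_map, Function.Embedding.coeFn_mk, Set.mem_image, Finset.mem_coe,
      Finset.mem_product, Finset.mem_range]
    refine ⟨((a - p.1).toNat, p.2), ?_, ?_⟩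
    · dsimp only
      omega
    · apply Prod.ext
      · simp only [e]
        omega
      · rfl

lemma FormalOp.OrderLE.mul {R : Type*} [NonUnitalNonAssocSemiring R] (D : ℤ → ℕ → R →+ R)
    {A B : FormalOp R} {a b : ℤ} (hA : A.OrderLE a) (hB : B.OrderLE b) :
    (FormalOp.mul D A B).OrderLE (a + b) := fun n hn => by
  rw [FormalOp.mul_coeff D hA hB n (K := 0) (by push_cast; omega)]
  rfl

lemma FormalOp.OrderLE.mono {R : Type*} [Zero R] {A : FormalOp R} {a b : ℤ} (hA : A.OrderLE a)
    (h : a ≤ b) : A.OrderLE b := fun i hi => hA i (lt_of_le_of_lt h hi)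

lemma FormalOp.exists_orderLE {R : Type*} [Zero R] (A : FormalOp R) : ∃ a, A.OrderLE a :=
  A.bddAbove

lemma FormalOp.exists_orderLE₂ {R : Type*} [Zero R] (A B : FormalOp R) :
    ∃ a, A.OrderLE a ∧ B.OrderLE a := by
  obtain ⟨a, ha⟩ := A.bddAbove
  obtain ⟨b, hb⟩ := B.bddAbove
  exact ⟨max a b, OrderLE.mono ha (le_max_left _ _), OrderLE.mono hb (le_max_right _ _)⟩

lemma FormalOp.mul_assoc' {R : Type*} [Ring R] {D : ℤ → ℕ → R →+ R} (hD : IsAssocRule D)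
    (A B C : FormalOp R) :
    FormalOp.mul D (FormalOp.mul D A B) C = FormalOp.mul D A (FormalOp.mul D B C) := by
  obtain ⟨a, hA⟩ := A.exists_orderLE
  obtain ⟨b, hB⟩ := B.exists_orderLE
  obtain ⟨c, hC⟩ := C.exists_orderLE
  ext n
  obtain ⟨K, hK⟩ : ∃ K : ℕ, a + b + c - n < K :=
    ⟨(a + b + c - n).toNat + 1, by push_cast; omega⟩
  rw [FormalOp.mul_coeff D (hA.mul D hB) hC n hK,
    FormalOp.mul_coeff D hA (hB.mul D hC) n (K := K) (by omega)]
  have e1 : ∀ y ∈ Finset.range K, ∀ p ∈ Finset.range K,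
      (FormalOp.mul D A B).coeff (a + b - y) * D (a + b - y) p (C.coeff (n - (a + b - y) + p)) =
      ∑ x ∈ Finset.range K, ∑ j ∈ Finset.range K, A.coeff (a - x) *
        (D (a - x) j (B.coeff (b - y + x + j)) *
          D (a + b - y) p (C.coeff (n - (a + b - y) + p))) := by
    intro y hy p hp
    rw [Finset.mem_range] at hy
    rw [FormalOp.mul_coeff D hA hB _ (K := K) (by omega), Finset.sum_mul]
    refine Finset.sum_congr rfl fun x _ => ?_
    rw [Finset.sum_mul]
    refine Finset.sum_congr rfl fun j _ => ?_
    rw [mul_assoc]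
    congr 5
    ring
  rw [Finset.sum_congr rfl fun y hy => Finset.sum_congr rfl (e1 y hy)]
  have e2 : ∀ x ∈ Finset.range K, ∀ q ∈ Finset.range K,
      A.coeff (a - x) * D (a - x) q ((FormalOp.mul D B C).coeff (n - (a - x) + q)) =
      ∑ z ∈ Finset.range K, ∑ s ∈ Finset.range K, A.coeff (a - x) *
        D (a - x) q (B.coeff (b - z) *
          D (b - z) s (C.coeff (n - (a - x) - (b - z) + q + s))) := by
    intro x hx q hq
    rw [FormalOp.mul_coeff D hB hC _ (K := K) (by omega), map_sum, Finset.mul_sum]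
    refine Finset.sum_congr rfl fun z _ => ?_
    rw [map_sum, Finset.mul_sum]
    refine Finset.sum_congr rfl fun s _ => ?_
    congr 6
    ring
  rw [Finset.sum_congr rfl fun x hx => Finset.sum_congr rfl (e2 x hx)]
  -- move the sum over `x` outside on the left
  have e3 : ∀ F : ℕ → ℕ → ℕ → ℕ → R, ∑ y ∈ Finset.range K, ∑ p ∈ Finset.range K,
      ∑ x ∈ Finset.range K, ∑ j ∈ Finset.range K, F y p x j =
      ∑ x ∈ Finset.range K, ∑ j ∈ Finset.range K, ∑ p ∈ Finset.range K,
        ∑ y ∈ Finset.range K, F y p x j := by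
    intro F
    rw [Finset.sum_comm]
    simp_rw [Finset.sum_comm (s := Finset.range K) (t := Finset.range K)
      (f := fun y x => ∑ j ∈ Finset.range K, F y _ x j)]
    rw [Finset.sum_comm]
    refine Finset.sum_congr rfl fun x _ => ?_
    simp_rw [Finset.sum_comm (s := Finset.range K) (t := Finset.range K)
      (f := fun y j => F y _ x j)]
    rw [Finset.sum_comm]
  rw [e3]
  refine Finset.sum_congr rfl fun x hx => ?_
  -- The drop `y` of the exponent of $AB$ below `a + b` is $x+j+z$: the drop in $A$, the derivatives
  -- falling on $B$, and the drop in $B$.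
  have e4 : ∀ j p : ℕ, ∑ y ∈ Finset.range K, A.coeff (a - x) *
        (D (a - x) j (B.coeff (b - y + x + j)) *
          D (a + b - y) p (C.coeff (n - (a + b - y) + p))) =
      ∑ z ∈ Finset.range K, A.coeff (a - x) *
        (D (a - x) j (B.coeff (b - z)) *
          D (a - x + (b - z) - j) p (C.coeff (n - (a - x) - (b - z) + (j + p : ℕ)))) := by
    intro j p
    rw [sum_range_shift _ (x + j) K]
    · refine Finset.sum_congr rfl fun z _ => ?_
      have h1 : b - ((x + j + z : ℕ) : ℤ) + x + j = b - z := by push_cast; ring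
      have h2 : a + b - ((x + j + z : ℕ) : ℤ) = a - x + (b - z) - j := by push_cast; ring
      have h3 : n - (a - x + (b - z) - j) + p = n - (a - x) - (b - z) + (j + p : ℕ) := by
        push_cast; ring
      rw [h1, h2, h3]
    · intro y hy
      rw [hB _ (by omega), map_zero, zero_mul, mul_zero]
    · intro y hy
      rw [hC _ (by omega), map_zero, mul_zero, mul_zero]
  simp_rw [e4]
  rw [Finset.sum_congr rfl fun j _ => Finset.sum_comm, Finset.sum_comm]
  conv_rhs => rw [Finset.sum_comm]
  refine Finset.sum_congr rfl fun z hz => ?_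
  -- For fixed `x` and `z` the coefficient of $C$ depends only on the total `T` of the two rule
  -- indices, so the associativity rule applies for each `T`.
  rw [sum_range_range_eq_sum_antidiagonal, sum_range_range_eq_sum_antidiagonal]
  · refine Finset.sum_congr rfl fun T _ => ?_
    have := congrArg (fun r => A.coeff (a - x) * r) (hD.assoc (a - x) (b - z) T (B.coeff (b - z))
      (C.coeff (n - (a - x) - (b - z) + T)))
    simp only [Finset.mul_sum] at this
    convert this using 1
    · refine Finset.sum_congr rfl fun q hq => ?_
      rw [Finset.HasAntidiagonal.mem_antidiagonal] at hq
      rw [hq]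
    · refine Finset.sum_congr rfl fun q hq => ?_
      rw [Finset.HasAntidiagonal.mem_antidiagonal] at hq
      rw [← hq]
      push_cast
      rw [add_assoc]
  · intro q s h
    rw [hC _ (by omega), map_zero, mul_zero, map_zero, mul_zero]
  · intro q s h
    rw [hC _ (by push_cast; omega), map_zero, mul_zero, mul_zero]

/-- The algebra of formal operators for an associative commutation rule. -/
def OpAlg {R : Type*} [Ring R] {D : ℤ → ℕ → R →+ R} (_ : IsAssocRule D) : Type _ := FormalOp R

section OpAlg

variable {R : Type*} [Ring R] {D : ℤ → ℕ → R →+ R} {hD : IsAssocRule D}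

/-- The coefficient of an element of the operator algebra. -/
abbrev OpAlg.coeff (A : OpAlg hD) (i : ℤ) : R := FormalOp.coeff A i

/-- `A` has order at most `a`. -/
abbrev OpAlg.OrderLE (A : OpAlg hD) (a : ℤ) : Prop := FormalOp.OrderLE A a

@[ext] lemma OpAlg.ext {A B : OpAlg hD} (h : ∀ i, A.coeff i = B.coeff i) : A = B :=
  FormalOp.ext (funext h)

instance : Zero (OpAlg hD) := ⟨⟨fun _ => 0, 0, fun _ _ => rfl⟩⟩

instance : Add (OpAlg hD) := ⟨fun A B => ⟨fun i => A.coeff i + B.coeff i, by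
  obtain ⟨a, hA, hB⟩ := FormalOp.exists_orderLE₂ A B
  exact ⟨a, fun i hi => by rw [OpAlg.coeff, OpAlg.coeff, hA i hi, hB i hi, add_zero]⟩⟩⟩

instance : Neg (OpAlg hD) := ⟨fun A => ⟨fun i => - A.coeff i, by
  obtain ⟨a, hA⟩ := FormalOp.exists_orderLE A
  exact ⟨a, fun i hi => by rw [OpAlg.coeff, hA i hi, neg_zero]⟩⟩⟩

instance : Sub (OpAlg hD) := ⟨fun A B => FormalOp.sub A B⟩

instance : Mul (OpAlg hD) := ⟨fun A B => FormalOp.mul D A B⟩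

@[simp] lemma OpAlg.coeff_zero (i : ℤ) : (0 : OpAlg hD).coeff i = 0 := rfl
@[simp] lemma OpAlg.coeff_add (A B : OpAlg hD) (i : ℤ) :
    (A + B).coeff i = A.coeff i + B.coeff i := rfl
@[simp] lemma OpAlg.coeff_neg (A : OpAlg hD) (i : ℤ) : (-A).coeff i = -A.coeff i := rfl
@[simp] lemma OpAlg.coeff_sub (A B : OpAlg hD) (i : ℤ) :
    (A - B).coeff i = A.coeff i - B.coeff i := rfl

lemma OpAlg.coeff_mul {A B : OpAlg hD} {a b : ℤ} (hA : A.OrderLE a) (hB : B.OrderLE b) (n : ℤ)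
    {K : ℕ} (hK : a + b - n < K) :
    (A * B).coeff n = ∑ x ∈ Finset.range K, ∑ j ∈ Finset.range K,
      A.coeff (a - x) * D (a - x) j (B.coeff (n - (a - x) + j)) :=
  FormalOp.mul_coeff D hA hB n hK

lemma OpAlg.exists_orderLE (A : OpAlg hD) : ∃ a, A.OrderLE a := A.bddAbove

lemma OpAlg.exists_orderLE₂ (A B : OpAlg hD) : ∃ a, A.OrderLE a ∧ B.OrderLE a :=
  FormalOp.exists_orderLE₂ A B

lemma OpAlg.OrderLE.mul {A B : OpAlg hD} {a b : ℤ} (hA : A.OrderLE a) (hB : B.OrderLE b) :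
    (A * B).OrderLE (a + b) := FormalOp.OrderLE.mul D hA hB

lemma OpAlg.OrderLE.add {A B : OpAlg hD} {a : ℤ} (hA : A.OrderLE a) (hB : B.OrderLE a) :
    (A + B).OrderLE a := fun i hi => by
  change A.coeff i + B.coeff i = 0
  rw [OpAlg.coeff, OpAlg.coeff, hA i hi, hB i hi, add_zero]

lemma OpAlg.exists_bound (n a b : ℤ) : ∃ K : ℕ, a + b - n < K :=
  ⟨(a + b - n).toNat + 1, by push_cast; omega⟩

instance : AddCommGroup (OpAlg hD) where
  add_assoc A B C := OpAlg.ext fun i => by simp [add_assoc]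
  zero_add A := OpAlg.ext fun i => by simp
  add_zero A := OpAlg.ext fun i => by simp
  add_comm A B := OpAlg.ext fun i => by simp [add_comm]
  neg_add_cancel A := OpAlg.ext fun i => by simp
  sub_eq_add_neg A B := OpAlg.ext fun i => by simp [sub_eq_add_neg]
  nsmul := nsmulRec
  zsmul := zsmulRec

/-- There is no unit in general: `IsAssocRule` does not determine `D i 0 1`, and even `D = 0`
satisfies it. Commutator identities need none. -/
instance : NonUnitalRing (OpAlg hD) where
  mul_assoc A B C := FormalOp.mul_assoc' hD A B C
  left_distrib A B C := by
    obtain ⟨a, hA⟩ := A.exists_orderLE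
    obtain ⟨b, hB, hC⟩ := OpAlg.exists_orderLE₂ B C
    ext n
    obtain ⟨K, hK⟩ := OpAlg.exists_bound n a b
    rw [OpAlg.coeff_add, OpAlg.coeff_mul hA hB n hK, OpAlg.coeff_mul hA hC n hK,
      OpAlg.coeff_mul hA (hB.add hC) n hK]
    simp only [OpAlg.coeff_add, map_add, mul_add, Finset.sum_add_distrib]
  right_distrib A B C := by
    obtain ⟨c, hC⟩ := C.exists_orderLE
    obtain ⟨b, hA, hB⟩ := OpAlg.exists_orderLE₂ A B
    ext n
    obtain ⟨K, hK⟩ := OpAlg.exists_bound n b c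
    rw [OpAlg.coeff_add, OpAlg.coeff_mul hA hC n hK, OpAlg.coeff_mul hB hC n hK,
      OpAlg.coeff_mul (hA.add hB) hC n hK]
    simp only [OpAlg.coeff_add, add_mul, Finset.sum_add_distrib]
  zero_mul A := by
    obtain ⟨a, hA⟩ := A.exists_orderLE
    ext n
    obtain ⟨K, hK⟩ := OpAlg.exists_bound n 0 a
    rw [OpAlg.coeff_mul (a := 0) (fun _ _ => rfl) hA n hK]
    simp
  mul_zero A := by
    obtain ⟨a, hA⟩ := A.exists_orderLE
    ext n
    obtain ⟨K, hK⟩ := OpAlg.exists_bound n a 0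
    rw [OpAlg.coeff_mul hA (b := 0) (fun _ _ => rfl) n hK]
    simp

end OpAlg

/-! ### Nonnegative parts, leading coefficients and coefficientwise derivations -/

section OpAlg

variable {R : Type*} [Ring R] {D : ℤ → ℕ → R →+ R} {hD : IsAssocRule D}

/-- The part with nonnegative exponents. -/
abbrev OpAlg.plus (A : OpAlg hD) : OpAlg hD := FormalOp.plus A

lemma OpAlg.coeff_plus (A : OpAlg hD) (i : ℤ) :
    A.plus.coeff i = if 0 ≤ i then A.coeff i else 0 := rfl

lemma OpAlg.plus_sub (A B : OpAlg hD) : (A - B).plus = A.plus - B.plus := by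
  ext i
  rw [OpAlg.coeff_sub, OpAlg.coeff_plus, OpAlg.coeff_plus, OpAlg.coeff_plus]
  split_ifs <;> simp

lemma OpAlg.sub_plus_orderLE (A : OpAlg hD) : (A - A.plus).OrderLE (-1) := fun i hi => by
  change A.coeff i - A.plus.coeff i = 0
  rw [OpAlg.coeff_plus, if_pos (by omega), sub_self]

lemma OpAlg.plus_eq_zero {A : OpAlg hD} (h : A.OrderLE (-1)) : A.plus = 0 := by
  ext i
  rw [OpAlg.coeff_plus]
  split_ifs with hi
  · exact h i (by omega)
  · rfl

lemma OpAlg.OrderLE.sub {A B : OpAlg hD} {a : ℤ} (hA : A.OrderLE a) (hB : B.OrderLE a) :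
    (A - B).OrderLE a := fun i hi => by
  change A.coeff i - B.coeff i = 0
  rw [OpAlg.coeff, OpAlg.coeff, hA i hi, hB i hi, sub_zero]

/-- The product of the leading terms. -/
lemma OpAlg.coeff_mul_top {A B : OpAlg hD} {a b : ℤ} (hA : A.OrderLE a) (hB : B.OrderLE b) :
    (A * B).coeff (a + b) = A.coeff a * D a 0 (B.coeff b) := by
  rw [OpAlg.coeff_mul hA hB (a + b) (K := 1) (by simp)]
  simp

/-- The subleading coefficient of a product. -/
lemma OpAlg.coeff_mul_subtop {A B : OpAlg hD} {a b : ℤ} (hA : A.OrderLE a) (hB : B.OrderLE b) :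
    (A * B).coeff (a + b - 1) = A.coeff a * D a 0 (B.coeff (b - 1)) + A.coeff a * D a 1 (B.coeff b)
      + A.coeff (a - 1) * D (a - 1) 0 (B.coeff b) := by
  rw [OpAlg.coeff_mul hA hB (a + b - 1) (K := 2) (by push_cast; omega)]
  have h1 : a + b - 1 - a = b - 1 := by ring
  have h2 : a + b - 1 - (a - 1) = b := by ring
  have h3 : B.coeff (b + 1) = 0 := hB _ (by omega)
  simp [Finset.sum_range_succ, h1, h2, h3]

/-- Moving $\xi^i$ with $i\ge0$ past a coefficient lowers the exponent by at most $i$, by `hpoly`,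
so no negative exponent can arise. -/
lemma OpAlg.plus_mul_plus_coeff_of_neg (hpoly : ∀ i j : ℕ, i < j → D i j = 0) (A B : OpAlg hD)
    {n : ℤ} (hn : n < 0) : (A.plus * B.plus).coeff n = 0 := by
  obtain ⟨a, hA⟩ := A.plus.exists_orderLE
  obtain ⟨b, hB⟩ := B.plus.exists_orderLE
  obtain ⟨K, hK⟩ := OpAlg.exists_bound n a b
  rw [OpAlg.coeff_mul hA hB n hK]
  refine Finset.sum_eq_zero fun x _ => Finset.sum_eq_zero fun j _ => ?_
  rw [OpAlg.coeff_plus, OpAlg.coeff_plus]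
  split_ifs with h1 h2
  · obtain ⟨i, hi⟩ := Int.eq_ofNat_of_zero_le h1
    rw [hi, hpoly i j (by omega)]
    simp
  all_goals simp

lemma OpAlg.plus_mul_plus (hpoly : ∀ i j : ℕ, i < j → D i j = 0) (A B : OpAlg hD) :
    (A.plus * B.plus).plus = A.plus * B.plus := by
  ext n
  rw [OpAlg.coeff_plus]
  split_ifs with h
  · rfl
  · exact (OpAlg.plus_mul_plus_coeff_of_neg hpoly A B (by omega)).symm

/-- The map `∑ a_i ξ^i ↦ ∑ (E a_i + c i a_i) ξ^i`. -/
def OpAlg.mapCoeff (E : R →+ R) (c : ℤ) (A : OpAlg hD) : OpAlg hD where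
  coeff i := E (A.coeff i) + (c * i) • A.coeff i
  bddAbove := by
    obtain ⟨a, hA⟩ := FormalOp.exists_orderLE A
    exact ⟨a, fun i hi => by rw [OpAlg.coeff, hA i hi, map_zero, smul_zero, add_zero]⟩

lemma OpAlg.coeff_mapCoeff (E : R →+ R) (c : ℤ) (A : OpAlg hD) (i : ℤ) :
    (A.mapCoeff E c).coeff i = E (A.coeff i) + (c * i) • A.coeff i := rfl

lemma OpAlg.coeff_mapCoeff_zero (E : R →+ R) (A : OpAlg hD) (i : ℤ) :
    (A.mapCoeff E 0).coeff i = E (A.coeff i) := by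
  rw [OpAlg.coeff_mapCoeff, zero_mul, zero_smul, add_zero]

lemma OpAlg.mapCoeff_sub (E : R →+ R) (c : ℤ) (A B : OpAlg hD) :
    (A - B).mapCoeff E c = A.mapCoeff E c - B.mapCoeff E c := by
  ext i
  simp only [OpAlg.coeff_mapCoeff, OpAlg.coeff_sub, map_sub, smul_sub]
  abel

lemma OpAlg.mapCoeff_plus (E : R →+ R) (c : ℤ) (A : OpAlg hD) :
    A.plus.mapCoeff E c = (A.mapCoeff E c).plus := by
  ext i
  simp only [OpAlg.coeff_mapCoeff, OpAlg.coeff_plus]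
  split_ifs <;> simp

lemma OpAlg.mapCoeff_orderLE {E : R →+ R} {c : ℤ} {A : OpAlg hD} {a : ℤ} (hA : A.OrderLE a) :
    (A.mapCoeff E c).OrderLE a := fun i hi => by
  change E (A.coeff i) + (c * i) • A.coeff i = 0
  rw [OpAlg.coeff, hA i hi, map_zero, smul_zero, add_zero]

/-- `mapCoeff E c` is a derivation when `E` is one and `E ∘ ξ = ξ ∘ (E + c)` in the appropriate
sense. -/
lemma OpAlg.mapCoeff_mul {E : R →+ R} {c : ℤ} (hE : ∀ x y, E (x * y) = E x * y + x * E y)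
    (hED : ∀ (i : ℤ) (j : ℕ) (x : R), E (D i j x) = D i j (E x + (c * j) • x)) (A B : OpAlg hD) :
    (A * B).mapCoeff E c = A.mapCoeff E c * B + A * B.mapCoeff E c := by
  obtain ⟨a, hA⟩ := A.exists_orderLE
  obtain ⟨b, hB⟩ := B.exists_orderLE
  ext n
  obtain ⟨K, hK⟩ := OpAlg.exists_bound n a b
  rw [OpAlg.coeff_add, OpAlg.coeff_mapCoeff, OpAlg.coeff_mul hA hB n hK,
    OpAlg.coeff_mul (OpAlg.mapCoeff_orderLE hA) hB n hK,
    OpAlg.coeff_mul hA (OpAlg.mapCoeff_orderLE hB) n hK]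
  simp only [map_sum, Finset.smul_sum, ← Finset.sum_add_distrib]
  refine Finset.sum_congr rfl fun x _ => Finset.sum_congr rfl fun j _ => ?_
  -- The multiple $cn$ splits because $n=i+(n-i+j)-j$ with $i=a-x$: exponent of $A$, plus exponent
  -- of $B$, minus the $j$ compensated by `hED`.
  rw [hE, hED, OpAlg.coeff_mapCoeff, OpAlg.coeff_mapCoeff, map_add, map_add, map_zsmul, map_zsmul]
  simp only [mul_add, add_mul, smul_mul_assoc, mul_smul_comm]
  module

/-! Evaluation of the coefficients -/

/-- The commutator of two operators, evaluated where all coefficients commute with `ξ`. -/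
lemma OpAlg.map_coeff_mul {R₀ : Type*} [Ring R₀] (ε : R →+* R₀)
    (h0 : ∀ i x, ε (D i 0 x) = ε x) (h1 : ∀ i j x, ε (D i (j + 1) x) = 0)
    {A B : OpAlg hD} {a b : ℤ} (hA : A.OrderLE a) (hB : B.OrderLE b) (n : ℤ) :
    ε ((A * B).coeff n) = ∑ i ∈ Finset.Icc (n - b) a, ε (A.coeff i) * ε (B.coeff (n - i)) := by
  obtain ⟨K, hK⟩ := OpAlg.exists_bound n a b
  rw [OpAlg.coeff_mul hA hB n (K := K + 1) (by push_cast; omega), map_sum]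
  have : ∀ x : ℕ, ε (∑ j ∈ Finset.range (K + 1),
      A.coeff (a - x) * D (a - x) j (B.coeff (n - (a - x) + j))) =
      ε (A.coeff (a - x)) * ε (B.coeff (n - (a - x))) := by
    intro x
    rw [Finset.sum_range_succ', map_add, map_mul, h0, map_sum, Finset.sum_eq_zero]
    · simp
    · intro j _
      rw [map_mul, h1, mul_zero]
  simp_rw [this]
  symm
  refine Finset.sum_of_injOn (fun i => (a - i).toNat) ?_ ?_ ?_ ?_
  · intro i hi j hj h
    simp only [Finset.coe_Icc, Set.mem_Icc] at hi hj h
    omega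
  · intro i hi
    simp only [Finset.coe_Icc, Set.mem_Icc, Finset.coe_range, Set.mem_Iio] at hi ⊢
    omega
  · intro x hx hx'
    rw [Finset.mem_range] at hx
    have : ¬ (n - b ≤ a - x) := fun h => hx' ⟨a - x, by
      simp only [Finset.coe_Icc, Set.mem_Icc]; omega, by simp⟩
    rw [show B.coeff (n - (a - x)) = 0 from hB _ (by omega), map_zero, mul_zero]
  · intro i hi
    rw [Finset.mem_Icc] at hi
    rw [show a - ((a - i).toNat : ℤ) = i by omega]

/-- Under `ε` the symbol commutes with coefficients, so products become convolutions; $i\mapsto n-i$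
aligns the two of them. -/
lemma OpAlg.map_coeff_comm {R₀ : Type*} [Ring R₀] (ε : R →+* R₀)
    (h0 : ∀ i x, ε (D i 0 x) = ε x) (h1 : ∀ i j x, ε (D i (j + 1) x) = 0)
    {A B : OpAlg hD} {a b : ℤ} (hA : A.OrderLE a) (hB : B.OrderLE b) (n : ℤ) :
    ε ((A * B - B * A).coeff n) = ∑ i ∈ Finset.Icc (n - b) a,
      (ε (A.coeff i) * ε (B.coeff (n - i)) - ε (B.coeff (n - i)) * ε (A.coeff i)) := by
  rw [OpAlg.coeff_sub, map_sub, OpAlg.map_coeff_mul ε h0 h1 hA hB,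
    OpAlg.map_coeff_mul ε h0 h1 hB hA, Finset.sum_sub_distrib]
  congr 1
  refine Finset.sum_nbij' (fun i => n - i) (fun i => n - i) ?_ ?_ ?_ ?_ ?_
  · intro i hi
    rw [Finset.mem_Icc] at hi ⊢
    omega
  · intro i hi
    rw [Finset.mem_Icc] at hi ⊢
    omega
  · intro i _
    ring
  · intro i _
    ring
  · intro i _
    rw [sub_sub_cancel]

/-! Lax flows -/

/-- `P` lies in the center of the centralizer of `L`. -/
def OpAlg.IsCentral (L P : OpAlg hD) : Prop :=
  P * L = L * P ∧ ∀ S : OpAlg hD, S * L = L * S → P * S = S * P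

lemma OpAlg.IsCentral.self (L : OpAlg hD) : L.IsCentral L := ⟨rfl, fun _ h => h.symm⟩

lemma OpAlg.IsCentral.mul_comm {L P Q : OpAlg hD} (hP : L.IsCentral P) (hQ : L.IsCentral Q) :
    P * Q = Q * P := hP.2 Q hQ.1

/-- The properties of the operator `L` and of the evaluation `ε` of its coefficients at `u = 0`
from which the commutativity of the Lax flows follows. -/
structure IsLaxSystem {R₀ : Type*} [Ring R₀] (L : OpAlg hD) (ε : R →+* R₀) : Prop where
  rule_eq_zero : ∀ i j : ℕ, i < j → D i j = 0
  eval_rule_zero : ∀ i x, ε (D i 0 x) = ε x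
  eval_rule_succ : ∀ i j x, ε (D i (j + 1) x) = 0
  eq_zero : ∀ Q : OpAlg hD, Q * L = L * Q → (∀ i, ε (Q.coeff i) = 0) → Q = 0
  commute : ∀ P Q : OpAlg hD, L.IsCentral P → L.IsCentral Q →
    ∀ i j, ε (P.coeff i) * ε (Q.coeff j) = ε (Q.coeff j) * ε (P.coeff i)

/-- `δ` is an evolution derivation of the coefficients with `δ L = [P_+, L]`. -/
structure IsLaxFlow (L P : OpAlg hD) (δ : R →+ R) : Prop where
  leibniz : ∀ x y, δ (x * y) = δ x * y + x * δ y
  rule : ∀ i j x, δ (D i j x) = D i j (δ x)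
  lax : L.mapCoeff δ 0 = P.plus * L - L * P.plus

lemma IsLaxFlow.mapCoeff_mul {L P : OpAlg hD} {δ : R →+ R} (h : IsLaxFlow L P δ)
    (A B : OpAlg hD) :
    (A * B).mapCoeff δ 0 = A.mapCoeff δ 0 * B + A * B.mapCoeff δ 0 :=
  OpAlg.mapCoeff_mul h.leibniz (fun i j x => by rw [h.rule, zero_mul, zero_smul, add_zero]) A B

variable {R₀ : Type*} [Ring R₀] {L : OpAlg hD} {ε : R →+* R₀}

/-- Commutators `[P_+, Q]` vanish at `u = 0`. -/
lemma IsLaxSystem.eval_comm (hL : IsLaxSystem L ε) {P Q : OpAlg hD} (hP : L.IsCentral P)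
    (hQ : L.IsCentral Q) (n : ℤ) : ε ((P.plus * Q - Q * P.plus).coeff n) = 0 := by
  obtain ⟨a, hA⟩ := P.plus.exists_orderLE
  obtain ⟨b, hB⟩ := Q.exists_orderLE
  rw [OpAlg.map_coeff_comm ε hL.eval_rule_zero hL.eval_rule_succ hA hB]
  refine Finset.sum_eq_zero fun i _ => ?_
  rw [OpAlg.coeff_plus]
  split_ifs
  · rw [hL.commute P Q hP hQ, sub_self]
  · simp

/-- The Lax equation for `L` implies the one for every `Q` in the center of the centralizer. -/
lemma IsLaxSystem.flow_eq (hL : IsLaxSystem L ε) {P Q : OpAlg hD} (hP : L.IsCentral P)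
    (hQ : L.IsCentral Q) {δ : R →+ R} (hδ : IsLaxFlow L P δ) (hε : ∀ x, ε (δ x) = 0) :
    Q.mapCoeff δ 0 = P.plus * Q - Q * P.plus := by
  rw [← sub_eq_zero]
  -- Rigidity at $u=0$ is applied to $\delta Q-[P_+,Q]$, which commutes with $L$ by the Leibniz rule
  -- for $[Q,L]=0$ and the Jacobi identity.
  apply hL.eq_zero
  · have h := congrArg (fun A => OpAlg.mapCoeff δ 0 A) hQ.1
    simp only [hδ.mapCoeff_mul, hδ.lax] at h
    have h1 : Q.mapCoeff δ 0 * L - L * Q.mapCoeff δ 0 =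
        (P.plus * L - L * P.plus) * Q - Q * (P.plus * L - L * P.plus) := by
      rw [sub_eq_sub_iff_add_eq_add, h]
    rw [← sub_eq_zero]
    calc _ = (Q.mapCoeff δ 0 * L - L * Q.mapCoeff δ 0) -
          (P.plus * (Q * L) - Q * (P.plus * L) - L * (P.plus * Q) + L * Q * P.plus) := by
          noncomm_ring
      _ = 0 := by
          rw [h1, hQ.1]
          simp only [mul_sub, sub_mul, mul_assoc]
          rw [← mul_assoc Q L P.plus, hQ.1]
          noncomm_ring
  · intro i
    rw [OpAlg.coeff_sub, map_sub, OpAlg.coeff_mapCoeff_zero, hε, hL.eval_comm hP hQ, sub_zero]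

/-- The zero curvature equation. -/
lemma IsLaxSystem.zero_curvature (hL : IsLaxSystem L ε) {P Q : OpAlg hD} (hP : L.IsCentral P)
    (hQ : L.IsCentral Q) {δ η : R →+ R} (hδ : IsLaxFlow L P δ) (hη : IsLaxFlow L Q η)
    (hεδ : ∀ x, ε (δ x) = 0) (hεη : ∀ x, ε (η x) = 0) :
    Q.plus.mapCoeff δ 0 - P.plus.mapCoeff η 0 = P.plus * Q.plus - Q.plus * P.plus := by
  rw [OpAlg.mapCoeff_plus, OpAlg.mapCoeff_plus, hL.flow_eq hP hQ hδ hεδ, hL.flow_eq hQ hP hη hεη,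
    ← OpAlg.plus_sub]
  have hminus : ((P - P.plus) * (Q - Q.plus) - (Q - Q.plus) * (P - P.plus)).plus = 0 := by
    apply OpAlg.plus_eq_zero
    have h1 := P.sub_plus_orderLE
    have h2 := Q.sub_plus_orderLE
    exact ((h1.mul h2).sub (h2.mul h1)).mono (by norm_num)
  have hPQ : P * Q - Q * P = 0 := sub_eq_zero.mpr (hP.mul_comm hQ)
  -- Expanding $P=P_++P_-$ and $Q=Q_++Q_-$ gives $[P_+,Q]-[Q_+,P]=[P_+,Q_+]-[P_-,Q_-]+[P,Q]$.
  have e : P.plus * Q - Q * P.plus - (Q.plus * P - P * Q.plus) =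
      (P.plus * Q.plus - Q.plus * P.plus) -
        ((P - P.plus) * (Q - Q.plus) - (Q - Q.plus) * (P - P.plus)) := by
    calc _ = (P.plus * Q.plus - Q.plus * P.plus) -
        ((P - P.plus) * (Q - Q.plus) - (Q - Q.plus) * (P - P.plus)) + (P * Q - Q * P) := by
          noncomm_ring
      _ = _ := by rw [hPQ, add_zero]
  rw [e, OpAlg.plus_sub, hminus, sub_zero, OpAlg.plus_sub,
    OpAlg.plus_mul_plus hL.rule_eq_zero, OpAlg.plus_mul_plus hL.rule_eq_zero]

/-- The Lax flows commute on `L`. -/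
lemma IsLaxSystem.flows_commute (hL : IsLaxSystem L ε) {P Q : OpAlg hD} (hP : L.IsCentral P)
    (hQ : L.IsCentral Q) {δ η : R →+ R} (hδ : IsLaxFlow L P δ) (hη : IsLaxFlow L Q η)
    (hεδ : ∀ x, ε (δ x) = 0) (hεη : ∀ x, ε (η x) = 0) (i : ℤ) :
    δ (η (L.coeff i)) = η (δ (L.coeff i)) := by
  suffices h : (L.mapCoeff η 0).mapCoeff δ 0 = (L.mapCoeff δ 0).mapCoeff η 0 by
    have := congrArg (fun A => OpAlg.coeff A i) h
    simpa only [OpAlg.coeff_mapCoeff_zero] using this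
  have hz := hL.zero_curvature hP hQ hδ hη hεδ hεη
  -- After $\delta$ is applied to $[Q_+,L]$ and $\eta$ to $[P_+,L]$, zero curvature eliminates
  -- $\delta Q_+$ and leaves the Jacobi identity.
  rw [hη.lax, hδ.lax, OpAlg.mapCoeff_sub, OpAlg.mapCoeff_sub, hδ.mapCoeff_mul, hδ.mapCoeff_mul,
    hη.mapCoeff_mul, hη.mapCoeff_mul, hδ.lax, hη.lax, sub_eq_iff_eq_add.mp hz]
  noncomm_ring

/-! The action of operators with nonnegative exponents on a module -/

/-- The action `∑_{i ≥ 0} a_i τ_i(v)` of an operator. -/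
def OpAlg.act {M : Type*} [AddCommGroup M] (ρ : R →+* AddMonoid.End M) (τ : ℕ → AddMonoid.End M)
    (A : OpAlg hD) (v : M) : M :=
  ∑ᶠ i : ℕ, ρ (A.coeff i) (τ i v)

section Action

variable {M : Type*} [AddCommGroup M] (ρ : R →+* AddMonoid.End M) (τ : ℕ → AddMonoid.End M)

lemma OpAlg.act_eq_sum {A : OpAlg hD} {K : ℕ} (hA : A.OrderLE (K - 1 : ℤ)) (v : M) :
    A.act ρ τ v = ∑ i ∈ Finset.range K, ρ (A.coeff i) (τ i v) := by
  refine finsum_eq_sum_of_support_subset _ fun i hi => ?_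
  rw [Finset.coe_range, Set.mem_Iio]
  by_contra h
  refine hi ?_
  dsimp only
  rw [OpAlg.coeff, hA i (by omega), map_zero]
  rfl

lemma OpAlg.exists_orderLE_nat (A : OpAlg hD) : ∃ K : ℕ, A.OrderLE (K - 1 : ℤ) := by
  obtain ⟨a, hA⟩ := A.exists_orderLE
  exact ⟨a.toNat + 1, hA.mono (by push_cast; omega)⟩

lemma OpAlg.exists_orderLE_nat₂ (A B : OpAlg hD) :
    ∃ K : ℕ, A.OrderLE (K - 1 : ℤ) ∧ B.OrderLE (K - 1 : ℤ) := by
  obtain ⟨a, hA, hB⟩ := OpAlg.exists_orderLE₂ A B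
  exact ⟨a.toNat + 1, hA.mono (by push_cast; omega), hB.mono (by push_cast; omega)⟩

lemma OpAlg.act_sub (A B : OpAlg hD) (v : M) :
    (A - B).act ρ τ v = A.act ρ τ v - B.act ρ τ v := by
  obtain ⟨K, hA, hB⟩ := OpAlg.exists_orderLE_nat₂ A B
  rw [OpAlg.act_eq_sum ρ τ hA, OpAlg.act_eq_sum ρ τ hB, OpAlg.act_eq_sum ρ τ (hA.sub hB),
    ← Finset.sum_sub_distrib]
  refine Finset.sum_congr rfl fun i _ => ?_
  rw [OpAlg.coeff_sub, map_sub]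
  rfl

/-- `hτ` is the commutation rule carried over to the module. It is asked only on vectors `τ l v`, as
these are what $B_+$ produces, and `i - j` is a true difference because `j ≤ i` in the sum. -/
lemma OpAlg.act_plus_mul (hpoly : ∀ i j : ℕ, i < j → D i j = 0)
    (hτ : ∀ (i l : ℕ) (r : R) (v : M), τ i (ρ r (τ l v)) =
      ∑ j ∈ Finset.range (i + 1), ρ (D i j r) (τ (i - j + l) v)) (A B : OpAlg hD) (v : M) :
    (A.plus * B.plus).act ρ τ v = A.plus.act ρ τ (B.plus.act ρ τ v) := by
  obtain ⟨K, hA, hB⟩ := OpAlg.exists_orderLE_nat₂ A.plus B.plus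
  have hcoeff : ∀ n : ℕ, (A.plus * B.plus).coeff n = ∑ i ∈ Finset.range K,
      ∑ j ∈ Finset.range (i + 1), A.plus.coeff i * D i j (B.plus.coeff (n - i + j)) := by
    intro n
    rw [Finset.sum_sigma']
    let e : (Σ _ : ℕ, ℕ) → ℤ × ℕ := fun q => (q.1, q.2)
    have he : Function.Injective e := by
      rintro ⟨x, j⟩ ⟨y, l⟩ h
      simp only [e, Prod.mk.injEq, Nat.cast_inj] at h
      obtain ⟨rfl, rfl⟩ := h
      rfl
    change ∑ᶠ p : ℤ × ℕ, A.plus.coeff p.1 * D p.1 p.2 (B.plus.coeff (n - p.1 + p.2)) = _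
    rw [finsum_eq_sum_of_support_subset
      (s := ((Finset.range K).sigma fun i => Finset.range (i + 1)).map ⟨e, he⟩)]
    · rw [Finset.sum_map]
      rfl
    · rintro ⟨i, j⟩ hp
      have h0 : 0 ≤ i := by
        by_contra h
        refine hp ?_
        dsimp only
        rw [OpAlg.coeff_plus, if_neg h, zero_mul]
      obtain ⟨i, rfl⟩ := Int.eq_ofNat_of_zero_le h0
      have h1 : i < K := by
        by_contra h
        refine hp ?_
        dsimp only
        rw [OpAlg.coeff, hA _ (by omega), zero_mul]
      have h2 : j ≤ i := not_lt.mp fun h => hp <| by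
        dsimp only
        rw [hpoly i j h, AddMonoidHom.zero_apply, mul_zero]
      simp only [Finset.coe_map, Function.Embedding.coeFn_mk, Set.mem_image, Finset.mem_coe,
        Finset.mem_sigma, Finset.mem_range]
      exact ⟨⟨i, j⟩, ⟨h1, Nat.lt_succ_of_le h2⟩, rfl⟩
  have hAB : (A.plus * B.plus).OrderLE (((2 * K : ℕ) : ℤ) - 1) :=
    (hA.mul hB).mono (by push_cast; omega)
  have hB' : B.plus.OrderLE (((2 * K : ℕ) : ℤ) - 1) := hB.mono (by push_cast; omega)
  rw [OpAlg.act_eq_sum ρ τ hAB, OpAlg.act_eq_sum ρ τ hA, OpAlg.act_eq_sum ρ τ hB']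
  have hρ : ∀ (w : M) (s : Finset ℕ) (f : ℕ → R), ρ (∑ i ∈ s, f i) w = ∑ i ∈ s, ρ (f i) w :=
    fun w s f => map_sum ((AddMonoidHom.eval w).comp ρ.toAddMonoidHom) f s
  have e1 : ∀ n : ℕ, ρ ((A.plus * B.plus).coeff n) (τ n v) = ∑ i ∈ Finset.range K,
      ∑ j ∈ Finset.range (i + 1),
        ρ (A.plus.coeff i) (ρ (D i j (B.plus.coeff (n - i + j))) (τ n v)) := by
    intro n
    rw [hcoeff, hρ]
    refine Finset.sum_congr rfl fun i _ => ?_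
    rw [hρ]
    refine Finset.sum_congr rfl fun j _ => ?_
    rw [map_mul]
    rfl
  simp_rw [e1]
  rw [Finset.sum_comm]
  refine Finset.sum_congr rfl fun i hi => ?_
  rw [Finset.sum_comm]
  simp_rw [map_sum, hτ]
  rw [Finset.mem_range] at hi
  rw [Finset.sum_congr rfl fun l _ => map_sum _ _ _]
  conv_rhs => rw [Finset.sum_comm]
  refine Finset.sum_congr rfl fun j hj => ?_
  rw [Finset.mem_range] at hj
  -- The total exponent is $i-j+l$, with $l$ the exponent from $B_+$. Terms below $i-j$ would take a
  -- coefficient of $B_+$ at a negative exponent.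
  rw [sum_range_shift _ (i - j)]
  · refine Finset.sum_congr rfl fun l _ => ?_
    rw [show (((i - j + l : ℕ) : ℤ) - i + j) = l by omega]
  · intro y hy
    rw [show B.plus.coeff (y - i + j) = 0 from if_neg (by omega)]
    simp
  · intro y hy
    rw [show B.plus.coeff (y - i + j) = 0 from hB _ (by omega)]
    simp

end Action

end OpAlg

/-! ### Order of the Lax commutator and flows on a module -/

section OpAlg

variable {R : Type*} [Ring R] {D : ℤ → ℕ → R →+ R} {hD : IsAssocRule D}

lemma OpAlg.exists_leading {A : OpAlg hD} (h : A ≠ 0) :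
    ∃ n, A.OrderLE n ∧ A.coeff n ≠ 0 := by
  obtain ⟨a, ha⟩ := A.exists_orderLE
  have hne : ∃ i, A.coeff i ≠ 0 := by
    by_contra! hc
    exact h (OpAlg.ext hc)
  obtain ⟨n, hn, hmax⟩ := Int.exists_greatest_of_bdd (P := fun i => A.coeff i ≠ 0)
    ⟨a, fun i hi => not_lt.mp fun h => hi (ha i h)⟩ hne
  refine ⟨n, fun i hi => ?_, hn⟩
  by_contra hc
  exact absurd (hmax i hc) (not_le.mpr hi)

/-- As $[P,L]=0$, the commutator can be computed from $P_-$, whose order is at most $-1$; this is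
what bounds the order of $[P_+,L]$. -/
lemma OpAlg.comm_plus_eq {L P : OpAlg hD} (h : P * L = L * P) :
    P.plus * L - L * P.plus = L * (P - P.plus) - (P - P.plus) * L := by
  calc _ = L * (P - P.plus) - (P - P.plus) * L + (P * L - L * P) := by noncomm_ring
    _ = _ := by rw [h, sub_self, add_zero]

lemma OpAlg.comm_plus_orderLE {L P : OpAlg hD} {N : ℤ} (h : P * L = L * P) (hL : L.OrderLE N) :
    (P.plus * L - L * P.plus).OrderLE (N - 1) := by
  rw [OpAlg.comm_plus_eq h]
  have h1 := P.sub_plus_orderLE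
  have h2 : (L * (P - P.plus)).OrderLE (N - 1) := (hL.mul h1).mono (by omega)
  have h3 : ((P - P.plus) * L).OrderLE (N - 1) := (h1.mul hL).mono (by omega)
  exact h2.sub h3

section Action

variable {M : Type*} [AddCommGroup M] (ρ : R →+* AddMonoid.End M) (τ : ℕ → AddMonoid.End M)

lemma OpAlg.map_act {δ : R →+ R} {Y : M →+ M} (hρ : ∀ r v, Y (ρ r v) = ρ (δ r) v + ρ r (Y v))
    (hτ : ∀ i v, Y (τ i v) = τ i (Y v)) (A : OpAlg hD) (v : M) :
    Y (A.act ρ τ v) = (A.mapCoeff δ 0).act ρ τ v + A.act ρ τ (Y v) := by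
  obtain ⟨K, hA⟩ := A.exists_orderLE_nat
  rw [OpAlg.act_eq_sum ρ τ hA, OpAlg.act_eq_sum ρ τ hA,
    OpAlg.act_eq_sum ρ τ (OpAlg.mapCoeff_orderLE hA), map_sum, ← Finset.sum_add_distrib]
  refine Finset.sum_congr rfl fun i _ => ?_
  rw [hρ, hτ, OpAlg.coeff_mapCoeff_zero]

/-- The extended Lax flows commute on `φ`. -/
lemma IsLaxSystem.flows_commute_act {R₀ : Type*} [Ring R₀] {L : OpAlg hD} {ε : R →+* R₀}
    (hL : IsLaxSystem L ε) {P Q : OpAlg hD} (hP : L.IsCentral P)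
    (hQ : L.IsCentral Q) {δ η : R →+ R} (hδ : IsLaxFlow L P δ) (hη : IsLaxFlow L Q η)
    (hεδ : ∀ x, ε (δ x) = 0) (hεη : ∀ x, ε (η x) = 0)
    (hτ : ∀ (i l : ℕ) (r : R) (v : M), τ i (ρ r (τ l v)) =
      ∑ j ∈ Finset.range (i + 1), ρ (D i j r) (τ (i - j + l) v)) {Y Z : M →+ M}
    (hYρ : ∀ r v, Y (ρ r v) = ρ (δ r) v + ρ r (Y v)) (hYτ : ∀ i v, Y (τ i v) = τ i (Y v))
    (hZρ : ∀ r v, Z (ρ r v) = ρ (η r) v + ρ r (Z v)) (hZτ : ∀ i v, Z (τ i v) = τ i (Z v))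
    {φ : M} (hYφ : Y φ = P.plus.act ρ τ φ) (hZφ : Z φ = Q.plus.act ρ τ φ) :
    Y (Z φ) = Z (Y φ) := by
  -- Since $YZ\varphi=(\delta Q_+)\varphi+Q_+P_+\varphi$ and symmetrically for $ZY\varphi$, zero
  -- curvature evaluated on $\varphi$ is the assertion.
  have h := congrArg (fun A => OpAlg.act ρ τ A φ) (hL.zero_curvature hP hQ hδ hη hεδ hεη)
  simp only [OpAlg.act_sub, OpAlg.act_plus_mul ρ τ hL.rule_eq_zero hτ] at h
  nth_rw 1 [hZφ]
  rw [OpAlg.map_act ρ τ hYρ hYτ, hYφ, OpAlg.map_act ρ τ hZρ hZτ, hZφ]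
  rw [sub_eq_sub_iff_add_eq_add] at h
  rw [h, add_comm]

end Action

end OpAlg

/-! Difference operators -/

section Shift

variable {k V : Type*} [Field k]

lemma shift_X (i : ℤ) (v : V) (s : ℤ) : shift k V i (X (v, s)) = X (v, s + i) := by
  simp [shift]

lemma shift_shift (i j : ℤ) (f : ShiftPoly k V) :
    shift k V i (shift k V j f) = shift k V (i + j) f := by
  simp only [shift, rename_rename]
  congr 2
  funext p
  simp only [Function.comp_apply, Prod.mk.injEq, true_and]
  ring

lemma shift_zero (f : ShiftPoly k V) : shift k V 0 f = f := by
  simp only [shift, add_zero]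
  exact rename_id_apply f

lemma shiftRule_zero (i : ℤ) (f : ShiftPoly k V) : shiftRule k V i 0 f = shift k V i f := rfl

lemma shiftRule_succ (i : ℤ) (j : ℕ) (f : ShiftPoly k V) : shiftRule k V i (j + 1) f = 0 := rfl

lemma shiftRule_pos (i : ℤ) {j : ℕ} (hj : j ≠ 0) : shiftRule k V i j = 0 := if_neg hj

lemma isAssocRule_shiftRule : IsAssocRule (shiftRule k V) where
  assoc i l T b c := by
    rcases Nat.eq_zero_or_pos T with rfl | hT
    · simp [shiftRule_zero, shift_shift]
    · rw [Finset.sum_eq_zero, Finset.sum_eq_zero]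
      · rintro ⟨q, s⟩ hx
        rw [Finset.HasAntidiagonal.mem_antidiagonal] at hx
        dsimp only at hx ⊢
        rcases eq_or_ne s 0 with rfl | hs
        · rw [shiftRule_pos i (j := q) (by omega), AddMonoidHom.zero_apply]
        · rw [shiftRule_pos l hs, AddMonoidHom.zero_apply, mul_zero, map_zero]
      · rintro ⟨q, s⟩ hx
        rw [Finset.HasAntidiagonal.mem_antidiagonal] at hx
        dsimp only at hx ⊢
        rcases eq_or_ne s 0 with rfl | hs
        · rw [shiftRule_pos i (j := q) (by omega), AddMonoidHom.zero_apply, zero_mul]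
        · rw [shiftRule_pos _ hs, AddMonoidHom.zero_apply, mul_zero]

/-- A difference polynomial fixed by a nontrivial shift is constant. -/
lemma eq_C_of_shift_eq {N : ℤ} (hN : N ≠ 0) {f : ShiftPoly k V} (h : shift k V N f = f) :
    f = C (constantCoeff f) := by
  classical
  suffices hv : f.vars = ∅ by
    rw [constantCoeff_eq]
    exact vars_eq_empty_iff_eq_C.mp hv
  -- The set of variables of `f` is stable under translation by $-N$, but it is finite, so it is
  -- empty.
  have hstep : ∀ p ∈ f.vars, (p.1, p.2 - N) ∈ f.vars := by
    intro p hp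
    rw [← h] at hp
    obtain ⟨q, hq, rfl⟩ := mem_vars_rename _ _ hp
    simpa using hq
  by_contra hne
  obtain ⟨p, hp⟩ := Finset.nonempty_iff_ne_empty.mpr hne
  have hall : ∀ n : ℕ, (p.1, p.2 - n * N) ∈ f.vars := by
    intro n
    induction n with
    | zero => simpa using hp
    | succ n ih =>
      have := hstep _ ih
      convert this using 2
      push_cast
      ring
  have hinj : Function.Injective fun n : ℕ => (p.1, p.2 - n * N) := by
    intro n n' h
    simpa [hN] using h
  exact Set.infinite_univ ((Set.Finite.subset (Finset.finite_toSet f.vars)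
    (Set.range_subset_iff.mpr hall)).preimage hinj.injOn |>.subset
      fun n _ => Set.mem_range_self n)

/-- The generic difference Lax operator as an element of the operator algebra. -/
abbrev shiftLaxOp (k : Type*) [Field k] (N : ℕ) :
    OpAlg (isAssocRule_shiftRule (k := k) (V := {i : ℤ // i < N})) :=
  shiftLax k N

lemma shiftLaxOp_orderLE (N : ℕ) : (shiftLaxOp k N).OrderLE N := fun i hi => by
  change (if h : i < N then _ else _) = _
  rw [dif_neg (by omega), if_neg (by omega)]

lemma shiftLaxOp_coeff_self (N : ℕ) : (shiftLaxOp k N).coeff N = 1 := by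
  change (if h : (N : ℤ) < N then _ else _) = _
  rw [dif_neg (by omega), if_pos rfl]

lemma shiftLaxOp_coeff_of_lt (N : ℕ) (v : {i : ℤ // i < N}) :
    (shiftLaxOp k N).coeff v = X (v, 0) := dif_pos v.2

/-- As $L$ is monic, comparing top coefficients in $QL=LQ$ gives $\triangle^Nq=q$, so $q$ is
constant and equals its value at $u=0$. The coefficients commute because they are scalars. -/
lemma isLaxSystem_shiftLaxOp {N : ℕ} (hN : 1 ≤ N) :
    IsLaxSystem (shiftLaxOp k N) (constantCoeff : ShiftPoly k {i : ℤ // i < N} →+* k) where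
  rule_eq_zero i j h := shiftRule_pos _ (by omega)
  eval_rule_zero i x := by
    rw [shiftRule_zero, shift, constantCoeff_rename]
  eval_rule_succ i j x := by rw [shiftRule_succ, map_zero]
  eq_zero Q hQ h := by
    by_contra hne
    obtain ⟨n, hn, hn0⟩ := OpAlg.exists_leading hne
    have h1 := OpAlg.coeff_mul_top hn (shiftLaxOp_orderLE (k := k) N)
    have h2 := OpAlg.coeff_mul_top (shiftLaxOp_orderLE (k := k) N) hn
    rw [hQ, add_comm, h2, shiftLaxOp_coeff_self, shiftRule_zero, shiftRule_zero, map_one,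
      one_mul, mul_one] at h1
    exact hn0 (by rw [eq_C_of_shift_eq (by omega) h1, h, C_0])
  commute P Q _ _ i j := mul_comm _ _

lemma shiftIncl_X (v : V) (s : ℤ) : shiftIncl k V (X (v, s)) = X (Sum.inl v, s) := by
  simp [shiftIncl]

lemma shiftIncl_shift (i : ℤ) (f : ShiftPoly k V) :
    shiftIncl k V (shift k V i f) = shift k (V ⊕ Unit) i (shiftIncl k V f) := by
  simp only [shift, shiftIncl, rename_rename]
  rfl

/-- The projection `φ ↦ 0`. -/
def shiftProj (k V : Type*) [Field k] : ShiftPoly k (V ⊕ Unit) →ₐ[k] ShiftPoly k V :=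
  aeval fun p => Sum.elim (fun v => X (v, p.2)) (fun _ => 0) p.1

lemma shiftProj_shiftIncl (f : ShiftPoly k V) : shiftProj k V (shiftIncl k V f) = f := by
  suffices h : (shiftProj k V).comp (shiftIncl k V) = AlgHom.id k _ from
    congrArg (fun g => g f) h
  apply algHom_ext
  rintro ⟨v, s⟩
  simp [shiftProj, shiftIncl]

lemma shiftProj_shift (i : ℤ) (f : ShiftPoly k (V ⊕ Unit)) :
    shiftProj k V (shift k (V ⊕ Unit) i f) = shift k V i (shiftProj k V f) := by
  suffices h : (shiftProj k V).comp (shift k _ i) = (shift k V i).comp (shiftProj k V) from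
    congrArg (fun g => g f) h
  apply algHom_ext
  rintro ⟨v | v, s⟩ <;> simp [shiftProj, shift]

/-- Reduces assertions about derivations commuting with shifts to the unshifted variables, which are
coefficients of $L$. -/
lemma shiftPoly_induction {p : ShiftPoly k V → Prop} (hC : ∀ c, p (C c))
    (hadd : ∀ f g, p f → p g → p (f + g)) (hmul : ∀ f g, p f → p g → p (f * g))
    (hshift : ∀ i f, p f → p (shift k V i f)) (hX : ∀ v, p (X (v, 0))) (f : ShiftPoly k V) :
    p f := by
  refine MvPolynomial.induction_on f hC hadd fun f q hf => hmul _ _ hf ?_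
  have := hshift q.2 _ (hX q.1)
  rwa [shift_X, zero_add] at this

/-- A derivation commuting with the shift commutes with all its powers. -/
lemma derivation_shift {Y : Derivation k (ShiftPoly k V) (ShiftPoly k V)}
    (hY : ∀ f, Y (shift k V 1 f) = shift k V 1 (Y f)) (i : ℤ) (f : ShiftPoly k V) :
    Y (shift k V i f) = shift k V i (Y f) := by
  have hinv : ∀ f, Y (shift k V (-1) f) = shift k V (-1) (Y f) := by
    intro f
    have := congrArg (shift k V (-1)) (hY (shift k V (-1) f))
    rw [shift_shift, shift_shift] at this
    simp only [add_neg_cancel, neg_add_cancel, shift_zero] at this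
    exact this.symm
  induction i using Int.induction_on generalizing f with
  | zero => rw [shift_zero, shift_zero]
  | succ n ih => rw [← shift_shift, ih, hY, shift_shift]
  | pred n ih => rw [sub_eq_add_neg, ← shift_shift, ih, hinv, shift_shift]

/-! ### Extended difference Lax flows -/

section Flow

variable {N : ℕ} {P Q : FormalOp (ShiftPoly k {i : ℤ // i < N})}
  {Y Z : Derivation k (ShiftPoly k ({i : ℤ // i < N} ⊕ Unit))
    (ShiftPoly k ({i : ℤ // i < N} ⊕ Unit))}

/-- The restriction of a flow to the polynomials in `u`. -/
def shiftRestrict (Y : Derivation k (ShiftPoly k (V ⊕ Unit)) (ShiftPoly k (V ⊕ Unit))) :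
    ShiftPoly k V →+ ShiftPoly k V :=
  ((shiftProj k V : ShiftPoly k (V ⊕ Unit) →+ ShiftPoly k V).comp
    (Y : ShiftPoly k (V ⊕ Unit) →+ ShiftPoly k (V ⊕ Unit))).comp
      (shiftIncl k V : ShiftPoly k V →+ ShiftPoly k (V ⊕ Unit))

lemma shiftRestrict_apply (Y : Derivation k (ShiftPoly k (V ⊕ Unit)) (ShiftPoly k (V ⊕ Unit)))
    (f : ShiftPoly k V) : shiftRestrict Y f = shiftProj k V (Y (shiftIncl k V f)) := rfl

lemma shiftRestrict_C (Y : Derivation k (ShiftPoly k (V ⊕ Unit)) (ShiftPoly k (V ⊕ Unit)))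
    (c : k) : shiftRestrict Y (C c) = 0 := by
  rw [shiftRestrict_apply, shiftIncl, rename_C, ← algebraMap_eq, Derivation.map_algebraMap,
    map_zero]

lemma shiftRestrict_mul (Y : Derivation k (ShiftPoly k (V ⊕ Unit)) (ShiftPoly k (V ⊕ Unit)))
    (f g : ShiftPoly k V) :
    shiftRestrict Y (f * g) = shiftRestrict Y f * g + f * shiftRestrict Y g := by
  simp only [shiftRestrict_apply, map_mul, Derivation.leibniz, smul_eq_mul, map_add,
    shiftProj_shiftIncl]
  ring

lemma IsExtShiftLaxFlow.restrict_shift {L P : FormalOp (ShiftPoly k V)}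
    {Y : Derivation k (ShiftPoly k (V ⊕ Unit)) (ShiftPoly k (V ⊕ Unit))}
    (hY : IsExtShiftLaxFlow L P Y) (i : ℤ) (f : ShiftPoly k V) :
    shiftRestrict Y (shift k V i f) = shift k V i (shiftRestrict Y f) := by
  rw [shiftRestrict_apply, shiftIncl_shift, derivation_shift hY.evolution, shiftProj_shift]
  rfl

lemma IsExtShiftLaxFlow.isLaxFlow {L P : OpAlg (isAssocRule_shiftRule (k := k) (V := V))}
    {Y : Derivation k (ShiftPoly k (V ⊕ Unit)) (ShiftPoly k (V ⊕ Unit))}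
    (hY : IsExtShiftLaxFlow L P Y) :
    IsLaxFlow L P (shiftRestrict Y) where
  leibniz := shiftRestrict_mul Y
  rule i j x := by
    cases j with
    | zero => exact hY.restrict_shift i x
    | succ j => rw [shiftRule_succ, shiftRule_succ, map_zero]
  lax := by
    ext1 i
    rw [OpAlg.coeff_mapCoeff_zero]
    exact (congrArg (shiftProj k V) (hY.lax i)).trans (shiftProj_shiftIncl _)

/-- The flow maps polynomials in $u$ to polynomials in $u$, since this holds on the coefficients of
$L$; hence setting $\varphi=0$ in `shiftRestrict` loses nothing. -/
lemma IsExtShiftLaxFlow.apply_shiftIncl (hY : IsExtShiftLaxFlow (shiftLax k N) P Y)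
    (f : ShiftPoly k {i : ℤ // i < N}) :
    Y (shiftIncl k _ f) = shiftIncl k _ (shiftRestrict Y f) := by
  induction f using shiftPoly_induction with
  | hC c => rw [shiftRestrict_C, shiftIncl, rename_C, ← algebraMap_eq, Derivation.map_algebraMap,
      map_zero]
  | hadd f g hf hg => simp only [map_add, hf, hg]
  | hmul f g hf hg =>
    rw [shiftRestrict_mul, map_mul, Derivation.leibniz, hf, hg, map_add, map_mul, map_mul,
      smul_eq_mul, smul_eq_mul]
    ring
  | hshift i f hf =>
    rw [shiftIncl_shift, derivation_shift hY.evolution, hf, hY.restrict_shift, shiftIncl_shift]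
  | hX v =>
    rw [shiftRestrict_apply, ← shiftLaxOp_coeff_of_lt, OpAlg.coeff, hY.lax, shiftProj_shiftIncl]

/-- On the generators the flow is given by the coefficients of $[P_+,L]$, which vanish at $u=0$; the
Leibniz rule and the shifts preserve this. -/
lemma IsExtShiftLaxFlow.constantCoeff_restrict (hN : 1 ≤ N)
    (hP : (shiftLaxOp k N).IsCentral P) (hY : IsExtShiftLaxFlow (shiftLax k N) P Y)
    (f : ShiftPoly k {i : ℤ // i < N}) : constantCoeff (shiftRestrict Y f) = 0 := by
  induction f using shiftPoly_induction with
  | hC c => rw [shiftRestrict_C, map_zero]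
  | hadd f g hf hg => simp only [map_add, hf, hg, add_zero]
  | hmul f g hf hg =>
    rw [shiftRestrict_mul, map_add, map_mul, map_mul, hf, hg, zero_mul, mul_zero, add_zero]
  | hshift i f hf => rw [hY.restrict_shift, shift, constantCoeff_rename, hf]
  | hX v =>
    rw [← shiftLaxOp_coeff_of_lt, ← OpAlg.coeff_mapCoeff_zero, hY.isLaxFlow.lax]
    exact (isLaxSystem_shiftLaxOp hN).eval_comm hP (OpAlg.IsCentral.self _) _

/-- Multiplication of polynomials in `u` and `φ` by polynomials in `u`. -/
def shiftMulHom (k V : Type*) [Field k] :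
    ShiftPoly k V →+* AddMonoid.End (ShiftPoly k (V ⊕ Unit)) :=
  (Module.toAddMonoidEnd (ShiftPoly k (V ⊕ Unit)) (ShiftPoly k (V ⊕ Unit))).comp
    (shiftIncl k V : ShiftPoly k V →+* ShiftPoly k (V ⊕ Unit))

lemma shiftMulHom_apply (f : ShiftPoly k V) (g : ShiftPoly k (V ⊕ Unit)) :
    shiftMulHom k V f g = shiftIncl k V f * g := rfl

/-- The shifts as additive endomorphisms. -/
def shiftEnd (k V : Type*) [Field k] (i : ℕ) : AddMonoid.End (ShiftPoly k V) :=
  (shift k V i : ShiftPoly k V →+ ShiftPoly k V)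

lemma shiftEnd_apply (i : ℕ) (f : ShiftPoly k V) : shiftEnd k V i f = shift k V i f := rfl

lemma shiftApply_eq_act (A : OpAlg (isAssocRule_shiftRule (k := k) (V := V))) :
    shiftApply A = A.act (shiftMulHom k V) (shiftEnd k (V ⊕ Unit)) (X (Sum.inr (), 0)) := by
  refine finsum_congr fun i => ?_
  rw [shiftEnd_apply, shift_X, zero_add]
  rfl

lemma derivation_ext_shift (hY : ∀ f, Y (shift k _ 1 f) = shift k _ 1 (Y f))
    (hZ : ∀ f, Z (shift k _ 1 f) = shift k _ 1 (Z f))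
    (hu : ∀ f, Y (shiftIncl k _ f) = Z (shiftIncl k _ f))
    (hφ : Y (X (Sum.inr (), 0)) = Z (X (Sum.inr (), 0))) : Y = Z := by
  apply derivation_ext
  rintro ⟨v | ⟨⟩, s⟩
  · rw [← shiftIncl_X, hu]
  · rw [← zero_add s, ← shift_X, derivation_shift hY, derivation_shift hZ, hφ]

lemma IsExtShiftLaxFlow.commute (hN : 1 ≤ N)
    (hP : (shiftLaxOp k N).IsCentral P) (hQ : (shiftLaxOp k N).IsCentral Q)
    (hY : IsExtShiftLaxFlow (shiftLax k N) P Y) (hZ : IsExtShiftLaxFlow (shiftLax k N) Q Z) :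
    ⁅Y, Z⁆ = 0 := by
  have hL := isLaxSystem_shiftLaxOp (k := k) hN
  have hYc := hY.constantCoeff_restrict hN hP
  have hZc := hZ.constantCoeff_restrict hN hQ
  have hu : ∀ f, shiftRestrict Y (shiftRestrict Z f) = shiftRestrict Z (shiftRestrict Y f) := by
    intro f
    induction f using shiftPoly_induction with
    | hC c => simp only [shiftRestrict_C, map_zero]
    | hadd f g hf hg => simp only [map_add, hf, hg]
    | hmul f g hf hg =>
      simp only [shiftRestrict_mul, map_add, hf, hg]
      ring
    | hshift i f hf => simp only [hY.restrict_shift, hZ.restrict_shift, hf]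
    | hX v =>
      rw [← shiftLaxOp_coeff_of_lt]
      exact hL.flows_commute hP hQ hY.isLaxFlow hZ.isLaxFlow hYc hZc _
  apply derivation_ext_shift
  · intro f
    simp only [Derivation.commutator_apply, hY.evolution, hZ.evolution, map_sub]
  · intro f
    simp
  · intro f
    rw [Derivation.commutator_apply, hZ.apply_shiftIncl, hY.apply_shiftIncl, hY.apply_shiftIncl,
      hZ.apply_shiftIncl, hu, sub_self]
    rfl
  · rw [Derivation.commutator_apply]
    refine sub_eq_zero.mpr ?_
    have hρ : ∀ {P : FormalOp (ShiftPoly k {i : ℤ // i < N})}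
      {Y : Derivation k (ShiftPoly k ({i : ℤ // i < N} ⊕ Unit))
        (ShiftPoly k ({i : ℤ // i < N} ⊕ Unit))}, IsExtShiftLaxFlow (shiftLax k N) P Y →
        ∀ r v, Y (shiftMulHom k _ r v) =
          shiftMulHom k _ (shiftRestrict Y r) v + shiftMulHom k _ r (Y v) := by
      intro P Y hY r v
      simp only [shiftMulHom_apply, Derivation.leibniz, smul_eq_mul, hY.apply_shiftIncl]
      ring
    refine hL.flows_commute_act (shiftMulHom k _) (shiftEnd k _) hP hQ hY.isLaxFlow hZ.isLaxFlow
      hYc hZc ?_ (Y := (Y : _ →+ _)) (Z := (Z : _ →+ _)) (hρ hY)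
      (fun i v => derivation_shift hY.evolution i v) (hρ hZ)
      (fun i v => derivation_shift hZ.evolution i v)
      (hY.ext.trans (shiftApply_eq_act _)) (hZ.ext.trans (shiftApply_eq_act _))
    intro i l r v
    rw [Finset.sum_range_succ', Finset.sum_eq_zero, zero_add]
    · simp only [shiftEnd_apply, shiftMulHom_apply, map_mul, shiftRule_zero, shiftIncl_shift,
        shift_shift]
      simp
    · intro j _
      rw [shiftRule_succ, map_zero]
      rfl

/-- All coefficients of $L$ below $\triangle^N$ are free, so the only constraint on $[P_+,L]$ is to
have order at most $N-1$. -/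
lemma existsUnique_isExtShiftLaxFlow (hP : (shiftLaxOp k N).IsCentral P) :
    ∃! Y, IsExtShiftLaxFlow (shiftLax k N) P Y := by
  set W : OpAlg (isAssocRule_shiftRule (k := k) (V := {i : ℤ // i < N})) :=
    OpAlg.plus P * shiftLaxOp k N - shiftLaxOp k N * OpAlg.plus P with hW
  have hWord : W.OrderLE (N - 1) := OpAlg.comm_plus_orderLE hP.1 (shiftLaxOp_orderLE N)
  let val : {i : ℤ // i < N} ⊕ Unit → ShiftPoly k ({i : ℤ // i < N} ⊕ Unit) :=
    Sum.elim (fun v => shiftIncl k _ (W.coeff v)) fun _ => shiftApply (FormalOp.plus P)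
  let Y : Derivation k (ShiftPoly k ({i : ℤ // i < N} ⊕ Unit))
      (ShiftPoly k ({i : ℤ // i < N} ⊕ Unit)) :=
    mkDerivation k fun p => shift k _ p.2 (val p.1)
  have hYX : ∀ v s, Y (X (v, s)) = shift k _ s (val v) := fun v s => mkDerivation_X _ _ _
  have hev : ∀ f, Y (shift k _ 1 f) = shift k _ 1 (Y f) := by
    intro f
    induction f using MvPolynomial.induction_on with
    | C c => rw [shift, rename_C, ← algebraMap_eq, Derivation.map_algebraMap, map_zero]
    | add f g hf hg => simp only [map_add, hf, hg]
    | mul_X f p hf =>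
      obtain ⟨v, s⟩ := p
      simp only [map_mul, Derivation.leibniz, map_add, smul_eq_mul, hf, shift_X, hYX, shift_shift]
      rw [add_comm 1 s]
  refine ⟨Y, ⟨hev, fun i => ?_, ?_⟩, fun Z hZ => ?_⟩
  · change Y (shiftIncl k _ ((shiftLaxOp k N).coeff i)) = shiftIncl k _ (W.coeff i)
    by_cases hi : i < N
    · rw [shiftLaxOp_coeff_of_lt N ⟨i, hi⟩, shiftIncl_X, hYX, shift_zero]
      rfl
    · rw [show W.coeff i = 0 from hWord i (by omega)]
      rcases eq_or_ne i N with rfl | hne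
      · rw [shiftLaxOp_coeff_self, map_one, Derivation.map_one_eq_zero, map_zero]
      · rw [show (shiftLaxOp k N).coeff i = 0 from shiftLaxOp_orderLE N i (by omega), map_zero,
          map_zero]
  · rw [hYX, shift_zero]
    rfl
  · refine derivation_ext_shift hZ.evolution hev (fun f => ?_) ?_
    · induction f using shiftPoly_induction with
      | hC c => rw [shiftIncl, rename_C, ← algebraMap_eq, Derivation.map_algebraMap,
          Derivation.map_algebraMap]
      | hadd f g hf hg => simp only [map_add, hf, hg]
      | hmul f g hf hg => simp only [map_mul, Derivation.leibniz, hf, hg]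
      | hshift i f hf =>
        rw [shiftIncl_shift, derivation_shift hZ.evolution, derivation_shift hev, hf]
      | hX v =>
        rw [shiftIncl_X, hYX, shift_zero, ← shiftIncl_X, ← shiftLaxOp_coeff_of_lt]
        exact hZ.lax _
    · rw [hYX, shift_zero]
      exact hZ.ext

end Flow

end Shift

/-! The commutation rule of a derivation -/

lemma end_mul_apply {M : Type*} [AddMonoid M] (f g : AddMonoid.End M) (x : M) :
    (f * g) x = f (g x) := rfl

/-- The iterated Leibniz rule. -/
lemma pow_apply_leibniz {A M : Type*} [AddCommGroup A] [AddCommGroup M] (μ : A →+ M →+ M)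
    (dA : AddMonoid.End A) (dM : AddMonoid.End M)
    (h : ∀ x v, dM (μ x v) = μ (dA x) v + μ x (dM v)) (n : ℕ) (x : A) (v : M) :
    (dM ^ n) (μ x v) = ∑ p ∈ Finset.HasAntidiagonal.antidiagonal n,
      n.choose p.1 • μ ((dA ^ p.1) x) ((dM ^ p.2) v) := by
  induction n with
  | zero => simp
  | succ n ih =>
    rw [Finset.sum_antidiagonal_choose_succ_nsmul
      (fun i j => μ ((dA ^ i) x) ((dM ^ j) v)), pow_succ', end_mul_apply, ih, map_sum,
      ← Finset.sum_add_distrib]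
    refine Finset.sum_congr rfl fun p hp => ?_
    rw [Finset.HasAntidiagonal.mem_antidiagonal] at hp
    rw [map_nsmul, h, smul_add, pow_succ', pow_succ', end_mul_apply,
      end_mul_apply, add_comm, ← Nat.choose_symm_of_eq_add hp.symm]

lemma choose_mul_choose_int (i : ℤ) (j r : ℕ) :
    Ring.choose i (j + r) * ((j + r).choose j : ℤ) = Ring.choose i j * Ring.choose (i - j) r := by
  have := Ring.choose_smul_choose i (Nat.le_add_right j r)
  rw [Nat.add_sub_cancel_left, nsmul_eq_mul] at this
  rw [← this, mul_comm]

/-- Vandermonde's identity for $\binom{(i-j)+l}{p}$ on the left and the iterated Leibniz rule on the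
right turn both sides into the same sum over triples of total `T`. -/
lemma isAssocRule_of_derivation {R : Type*} [Ring R] {d : AddMonoid.End R}
    (hd : ∀ x y, d (x * y) = d x * y + x * d y) {D : ℤ → ℕ → R →+ R}
    (hD : ∀ i j x, D i j x = Ring.choose i j • (d ^ j) x) : IsAssocRule D where
  assoc i l T b c := by
    simp only [hD]
    have e1 : ∀ p ∈ Finset.HasAntidiagonal.antidiagonal T,
        (Ring.choose i p.1 • (d ^ p.1) b) * (Ring.choose (i + l - p.1) p.2 • (d ^ p.2) c) =
        ∑ q ∈ Finset.HasAntidiagonal.antidiagonal p.2,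
          (Ring.choose i p.1 * Ring.choose (i - p.1) q.1 * Ring.choose l q.2) •
            ((d ^ p.1) b * (d ^ (q.1 + q.2)) c) := by
      intro p _
      rw [show i + l - p.1 = (i - p.1) + l by ring, Ring.add_choose_eq _ (Commute.all _ _),
        Finset.sum_smul, Finset.mul_sum]
      refine Finset.sum_congr rfl fun q hq => ?_
      rw [Finset.HasAntidiagonal.mem_antidiagonal] at hq
      rw [hq, smul_mul_smul_comm, mul_assoc]
    have e2 : ∀ p ∈ Finset.HasAntidiagonal.antidiagonal T,
        Ring.choose i p.1 • (d ^ p.1) (b * Ring.choose l p.2 • (d ^ p.2) c) =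
        ∑ q ∈ Finset.HasAntidiagonal.antidiagonal p.1,
          (Ring.choose i q.1 * Ring.choose (i - q.1) q.2 * Ring.choose l p.2) •
            ((d ^ q.1) b * (d ^ (q.2 + p.2)) c) := by
      intro p _
      have := pow_apply_leibniz (AddMonoidHom.mul (R := R)) d d hd p.1 b
        (Ring.choose l p.2 • (d ^ p.2) c)
      rw [AddMonoidHom.mul_apply] at this
      rw [this, Finset.smul_sum]
      refine Finset.sum_congr rfl fun q hq => ?_
      rw [Finset.HasAntidiagonal.mem_antidiagonal] at hq
      rw [← choose_mul_choose_int, hq, AddMonoidHom.mul_apply, map_zsmul, mul_smul_comm, pow_add,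
        end_mul_apply, ← Nat.cast_smul_eq_nsmul ℤ, smul_smul, smul_smul]
    rw [Finset.sum_congr rfl e1, Finset.sum_congr rfl e2, Finset.sum_sigma', Finset.sum_sigma']
    refine Finset.sum_nbij' (fun s => ⟨(s.1.1 + s.2.1, s.2.2), (s.1.1, s.2.1)⟩)
      (fun s => ⟨(s.2.1, s.2.2 + s.1.2), (s.2.2, s.1.2)⟩) ?_ ?_ ?_ ?_ ?_
    · rintro ⟨⟨j, p⟩, ⟨r, s⟩⟩ h
      simp only [Finset.mem_sigma, Finset.HasAntidiagonal.mem_antidiagonal] at h ⊢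
      obtain ⟨rfl, rfl⟩ := h
      exact ⟨by ring, trivial⟩
    · rintro ⟨⟨j, p⟩, ⟨r, s⟩⟩ h
      simp only [Finset.mem_sigma, Finset.HasAntidiagonal.mem_antidiagonal] at h ⊢
      obtain ⟨rfl, rfl⟩ := h
      exact ⟨by ring, trivial⟩
    · rintro ⟨⟨j, p⟩, ⟨r, s⟩⟩ h
      simp only [Finset.mem_sigma, Finset.HasAntidiagonal.mem_antidiagonal] at h
      obtain ⟨-, rfl⟩ := h
      rfl
    · rintro ⟨⟨j, p⟩, ⟨r, s⟩⟩ h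
      simp only [Finset.mem_sigma, Finset.HasAntidiagonal.mem_antidiagonal] at h
      obtain ⟨-, rfl⟩ := h
      rfl
    · rintro ⟨⟨j, p⟩, ⟨r, s⟩⟩ -
      rfl

/-! Weights -/

section Weight

variable {R : Type*} [Ring R] {D : ℤ → ℕ → R →+ R} {hD : IsAssocRule D}

/-- The coefficient as an additive map. -/
def OpAlg.coeffHom (hD : IsAssocRule D) (i : ℤ) : OpAlg hD →+ R where
  toFun A := A.coeff i
  map_zero' := rfl
  map_add' _ _ := rfl

lemma OpAlg.coeff_zsmul (z : ℤ) (A : OpAlg hD) (i : ℤ) : (z • A).coeff i = z • A.coeff i :=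
  map_zsmul (OpAlg.coeffHom hD i) z A

/-- A derivation of the operator algebra that multiplies `L` by an integer preserves the center of
the centralizer of `L`. -/
lemma OpAlg.IsCentral.map {L P : OpAlg hD} (hP : L.IsCentral P) {T : OpAlg hD → OpAlg hD}
    (hT : ∀ A B, T (A * B) = T A * B + A * T B) {z : ℤ} (hTL : T L = z • L) :
    L.IsCentral (T P) := by
  -- Applying `T` to $SL=LS$ produces $z\,SL$ and $z\,LS$, which cancel; so `T` preserves the
  -- centralizer, and the same argument with $PS=SP$ then handles its center.
  have hcent : ∀ S : OpAlg hD, S * L = L * S → T S * L = L * T S := by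
    intro S hS
    have h := congrArg T hS
    rw [hT, hT, hTL, mul_smul_comm, smul_mul_assoc, hS, add_comm (z • _)] at h
    exact add_right_cancel h
  refine ⟨hcent P hP.1, fun S hS => ?_⟩
  have h := congrArg T (hP.2 S hS)
  rw [hT, hT, hP.2 _ (hcent S hS), add_comm (T S * P)] at h
  exact add_right_cancel h

lemma eq_zero_of_sum_pow_smul_eq_zero (k : Type*) {M : Type*} [Field k] [CharZero k]
    [AddCommGroup M] [Module k M] (s : Finset ℤ) (x : ℤ → M)
    (h : ∀ t : ℕ, ∑ i ∈ s, (i ^ t) • x i = 0) : ∀ i ∈ s, x i = 0 := by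
  intro i hi
  have hp : ∀ p : Polynomial ℤ, ∑ i ∈ s, p.eval i • x i = 0 := by
    intro p
    induction p using Polynomial.induction_on' with
    | add p q hp hq => simp only [Polynomial.eval_add, add_smul, Finset.sum_add_distrib, hp, hq,
        add_zero]
    | monomial t c =>
      simp only [Polynomial.eval_monomial, mul_smul]
      rw [← Finset.smul_sum, h, smul_zero]
  -- This polynomial vanishes at every other node and is a nonzero integer at `i`, hence invertible
  -- in `k`.
  have h1 := hp (∏ j ∈ s.erase i, (Polynomial.X - Polynomial.C j))
  rw [Finset.sum_eq_single i] at h1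
  · rw [← Int.cast_smul_eq_zsmul k, smul_eq_zero, Int.cast_eq_zero, Polynomial.eval_prod,
      Finset.prod_eq_zero_iff] at h1
    refine h1.resolve_left ?_
    rintro ⟨j, hj, hj0⟩
    rw [Polynomial.eval_sub, Polynomial.eval_X, Polynomial.eval_C, sub_eq_zero] at hj0
    exact Finset.ne_of_mem_erase hj hj0.symm
  · intro j hj hji
    rw [Polynomial.eval_prod, Finset.prod_eq_zero (Finset.mem_erase.mpr ⟨hji, hj⟩), zero_smul]
    simp
  · exact fun h => absurd hi h

/-- If the center of the centralizer of `L` is graded by means of a weight derivation, then the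
coefficients at `u = 0` of its elements commute. -/
lemma OpAlg.IsCentral.map_coeff_commute (k : Type*) [Field k] [CharZero k] {R₀ : Type*} [Ring R₀]
    [Module k R₀] (ε : R →+* R₀)
    (h0 : ∀ i x, ε (D i 0 x) = ε x) (h1 : ∀ i j x, ε (D i (j + 1) x) = 0)
    {E : R →+ R} (hE : ∀ x y, E (x * y) = E x * y + x * E y)
    (hED : ∀ (i : ℤ) (j : ℕ) (x : R), E (D i j x) = D i j (E x + ((1 : ℤ) * j) • x))
    (hεE : ∀ x, ε (E x) = 0) {L P Q : OpAlg hD} {z : ℤ} (hL : L.mapCoeff E 1 = z • L)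
    (hP : L.IsCentral P) (hQ : L.IsCentral Q) (i j : ℤ) :
    ε (P.coeff i) * ε (Q.coeff j) = ε (Q.coeff j) * ε (P.coeff i) := by
  let T : OpAlg hD → OpAlg hD := fun A => A.mapCoeff E 1
  have hcent : ∀ t : ℕ, L.IsCentral (T^[t] P) := by
    intro t
    induction t with
    | zero => exact hP
    | succ t ih =>
      rw [Function.iterate_succ_apply']
      exact ih.map (OpAlg.mapCoeff_mul hE hED) hL
  -- At $u=0$ the derivation `E` contributes nothing, so each application of `T` only multiplies by
  -- the exponent.
  have hcoeff : ∀ (t : ℕ) (i : ℤ), ε ((T^[t] P).coeff i) = i ^ t • ε (P.coeff i) := by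
    intro t i
    induction t with
    | zero => simp
    | succ t ih =>
      rw [Function.iterate_succ_apply', OpAlg.coeff_mapCoeff, map_add, hεE, map_zsmul, ih,
        zero_add, one_mul, smul_smul, pow_succ']
  obtain ⟨a, ha⟩ := P.exists_orderLE
  have hord : ∀ t : ℕ, (T^[t] P).OrderLE a := by
    intro t
    induction t with
    | zero => exact ha
    | succ t ih =>
      rw [Function.iterate_succ_apply']
      exact OpAlg.mapCoeff_orderLE ih
  obtain ⟨b, hb⟩ := Q.exists_orderLE
  by_cases hi : a < i
  · rw [show P.coeff i = 0 from ha i hi, map_zero, zero_mul, mul_zero]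
  by_cases hj : b < j
  · rw [show Q.coeff j = 0 from hb j hj, map_zero, zero_mul, mul_zero]
  have key := eq_zero_of_sum_pow_smul_eq_zero k (Finset.Icc (i + j - b) a)
    (fun l => ε (P.coeff l) * ε (Q.coeff (i + j - l)) - ε (Q.coeff (i + j - l)) * ε (P.coeff l))
    (fun t => ?_) i (Finset.mem_Icc.mpr ⟨by omega, by omega⟩)
  · rwa [add_sub_cancel_left, sub_eq_zero] at key
  · have := OpAlg.map_coeff_comm ε h0 h1 (hord t) hb (i + j)
    rw [(hcent t).mul_comm hQ, sub_self, OpAlg.coeff_zero, map_zero] at this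
    rw [this]
    refine Finset.sum_congr rfl fun l _ => ?_
    rw [hcoeff, smul_sub, smul_mul_assoc, mul_smul_comm]

end Weight

/-! Differential polynomials -/

section Diff

variable {k V : Type*} [Field k]

lemma totalDeriv_X (v : V) (j : ℕ) : totalDeriv k V (X (v, j)) = X (v, j + 1) :=
  mkDerivation_X _ _ _

lemma derivation_C {σ : Type*} (Y : Derivation k (MvPolynomial σ k) (MvPolynomial σ k)) (c : k) :
    Y (C c) = 0 := by
  rw [← algebraMap_eq, Derivation.map_algebraMap]

lemma constantCoeff_derivation {σ : Type*} {Y : Derivation k (MvPolynomial σ k) (MvPolynomial σ k)}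
    (h : ∀ i, constantCoeff (Y (X i)) = 0) (f : MvPolynomial σ k) : constantCoeff (Y f) = 0 := by
  induction f using MvPolynomial.induction_on with
  | C c => rw [derivation_C, map_zero]
  | add f g hf hg => rw [map_add, map_add, hf, hg, add_zero]
  | mul_X f i hf => simp [Derivation.leibniz, hf, h]

lemma constantCoeff_totalDeriv (f : DiffPoly k V) : constantCoeff (totalDeriv k V f) = 0 :=
  constantCoeff_derivation (fun p => by rw [totalDeriv_X, constantCoeff_X]) f

/-- The constants of the ring of differential polynomials. -/
lemma eq_C_of_totalDeriv_eq_zero [CharZero k] {f : DiffPoly k V} (h : totalDeriv k V f = 0) :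
    f = C (constantCoeff f) := by
  classical
  -- From $[\partial/\partial v^{(j+1)},\partial]=\partial/\partial v^{(j)}$ and $\partial f=0$,
  -- independence of $v^{(j+1)}$ passes down to $v^{(j)}$. The descent starts above the highest
  -- derivative occurring in `f`.
  have hcomm : ∀ v j, ⁅(pderiv (v, j + 1) : Derivation k (DiffPoly k V) (DiffPoly k V)),
      totalDeriv k V⁆ = pderiv (v, j) := by
    intro v j
    apply derivation_ext
    rintro ⟨w, l⟩
    rw [Derivation.commutator_apply, totalDeriv_X, pderiv_X, pderiv_X, pderiv_X]
    rw [Pi.single_apply, Pi.single_apply, Pi.single_apply]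
    split_ifs <;> simp_all
  have hstep : ∀ v j, pderiv (v, j + 1) f = 0 → pderiv (v, j) f = 0 := by
    intro v j hv
    rw [← hcomm, Derivation.commutator_apply, h, hv, map_zero, map_zero, sub_zero]
  have hzero : ∀ p, pderiv p f = 0 := by
    rintro ⟨v, j⟩
    obtain ⟨B, hB⟩ : ∃ B : ℕ, ∀ p ∈ f.vars, p.2 < B :=
      ⟨f.vars.sup (fun p => p.2) + 1, fun p hp =>
        Nat.lt_succ_of_le (Finset.le_sup (f := fun p : V × ℕ => p.2) hp)⟩
    have hdesc : ∀ n : ℕ, ∀ j, B ≤ j + n → pderiv (v, j) f = 0 := by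
      intro n
      induction n with
      | zero =>
        intro j hj
        exact pderiv_eq_zero_of_notMem_vars fun hv => absurd (hB _ hv) (not_lt.mpr hj)
      | succ n ih => exact fun j hj => hstep v j (ih (j + 1) (by omega))
    exact hdesc B j (by omega)
  ext s
  rw [coeff_C, constantCoeff_eq]
  split_ifs with hs
  · rw [hs]
  · obtain ⟨p, hp⟩ : ∃ p, s p ≠ 0 := by
      by_contra! hc
      exact hs (Finsupp.ext hc).symm
    have := congrArg (coeff (s - Finsupp.single p 1)) (hzero p)
    rw [coeff_pderiv, coeff_zero, mul_eq_zero] at this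
    rcases this with this | this
    · rwa [tsub_add_cancel_of_le] at this
      rw [Finsupp.single_le_iff]
      omega
    · exact absurd this (Nat.cast_add_one_ne_zero _)

lemma diffPoly_induction {p : DiffPoly k V → Prop} (hC : ∀ c, p (C c))
    (hadd : ∀ f g, p f → p g → p (f + g)) (hmul : ∀ f g, p f → p g → p (f * g))
    (hderiv : ∀ f, p f → p (totalDeriv k V f)) (hX : ∀ v, p (X (v, 0))) (f : DiffPoly k V) :
    p f := by
  refine MvPolynomial.induction_on f hC hadd fun f q hf => hmul _ _ hf ?_
  obtain ⟨v, j⟩ := q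
  induction j with
  | zero => exact hX v
  | succ j ih =>
    rw [← totalDeriv_X]
    exact hderiv _ ih

/-- Entrywise total derivative of matrices. -/
def matDeriv (k V : Type*) [Field k] (m : ℕ) :
    AddMonoid.End (Matrix (Fin m) (Fin m) (DiffPoly k V)) :=
  AddMonoidHom.mapMatrix (totalDeriv k V : DiffPoly k V →+ DiffPoly k V)

variable {m : ℕ}

lemma matDeriv_apply (A : Matrix (Fin m) (Fin m) (DiffPoly k V)) (α β : Fin m) :
    matDeriv k V m A α β = totalDeriv k V (A α β) := rfl

lemma matDeriv_mul (A B : Matrix (Fin m) (Fin m) (DiffPoly k V)) :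
    matDeriv k V m (A * B) = matDeriv k V m A * B + A * matDeriv k V m B := by
  ext1 α β
  simp only [matDeriv_apply, Matrix.mul_apply, Matrix.add_apply, map_sum, Derivation.leibniz,
    smul_eq_mul, ← Finset.sum_add_distrib]
  refine Finset.sum_congr rfl fun γ _ => ?_
  ring

lemma matDeriv_map_C (a : Matrix (Fin m) (Fin m) k) : matDeriv k V m (a.map C) = 0 := by
  ext1 α β
  rw [matDeriv_apply, Matrix.map_apply, derivation_C]
  rfl

lemma matDeriv_pow_apply (j : ℕ) (A : Matrix (Fin m) (Fin m) (DiffPoly k V)) (α β : Fin m) :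
    ((matDeriv k V m ^ j) A) α β =
      ((totalDeriv k V : Module.End k (DiffPoly k V)) ^ j) (A α β) := by
  induction j with
  | zero => rfl
  | succ j ih =>
    rw [pow_succ', pow_succ', end_mul_apply, matDeriv_apply, ih]
    rfl

lemma diffRule_apply (i : ℤ) (j : ℕ) (A : Matrix (Fin m) (Fin m) (DiffPoly k V)) :
    diffRule k V m i j A = Ring.choose i j • (matDeriv k V m ^ j) A := by
  change Ring.choose i j •
    (((totalDeriv k V : Module.End k (DiffPoly k V)) ^ j).toAddMonoidHom.mapMatrix A) = _
  congr 1
  ext1 α β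
  rw [matDeriv_pow_apply]
  rfl

lemma diffRule_zero (i : ℤ) (A : Matrix (Fin m) (Fin m) (DiffPoly k V)) :
    diffRule k V m i 0 A = A := by
  rw [diffRule_apply, Ring.choose_zero_right, one_smul]
  rfl

lemma diffRule_one (i : ℤ) (A : Matrix (Fin m) (Fin m) (DiffPoly k V)) :
    diffRule k V m i 1 A = i • matDeriv k V m A := by
  rw [diffRule_apply, Ring.choose_one_right, pow_one]

lemma diffRule_eq_zero (i j : ℕ) (h : i < j) : diffRule k V m i j = 0 := by
  ext1 A
  rw [diffRule_apply, Ring.choose_natCast, Nat.choose_eq_zero_of_lt h, Nat.cast_zero, zero_smul]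
  rfl

lemma isAssocRule_diffRule : IsAssocRule (diffRule k V m) :=
  isAssocRule_of_derivation matDeriv_mul diffRule_apply

/-- Evaluation of matrices at `u = 0`. -/
def matEval (k V : Type*) [Field k] (m : ℕ) :
    Matrix (Fin m) (Fin m) (DiffPoly k V) →+* Matrix (Fin m) (Fin m) k :=
  (constantCoeff : DiffPoly k V →+* k).mapMatrix

lemma matEval_apply (A : Matrix (Fin m) (Fin m) (DiffPoly k V)) (α β : Fin m) :
    matEval k V m A α β = constantCoeff (A α β) := rfl

lemma matEval_matDeriv (A : Matrix (Fin m) (Fin m) (DiffPoly k V)) :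
    matEval k V m (matDeriv k V m A) = 0 := by
  ext1 α β
  rw [matEval_apply, matDeriv_apply, constantCoeff_totalDeriv]
  rfl

lemma matEval_diffRule_zero (i : ℤ) (A : Matrix (Fin m) (Fin m) (DiffPoly k V)) :
    matEval k V m (diffRule k V m i 0 A) = matEval k V m A := by
  rw [diffRule_zero]

lemma matEval_diffRule_succ (i : ℤ) (j : ℕ) (A : Matrix (Fin m) (Fin m) (DiffPoly k V)) :
    matEval k V m (diffRule k V m i (j + 1) A) = 0 := by
  rw [diffRule_apply, map_zsmul, pow_succ', end_mul_apply, matEval_matDeriv, smul_zero]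

/-- The commutation rule commutes with evolution derivations up to a weight. -/
lemma mapMatrix_diffRule {E : DiffPoly k V →+ DiffPoly k V} {c : ℤ}
    (hE : ∀ f, E (totalDeriv k V f) = totalDeriv k V (E f + c • f)) (i : ℤ) (j : ℕ)
    (A : Matrix (Fin m) (Fin m) (DiffPoly k V)) :
    E.mapMatrix (diffRule k V m i j A) = diffRule k V m i j (E.mapMatrix A + (c * j) • A) := by
  have hE' : ∀ A, E.mapMatrix (matDeriv k V m A) = matDeriv k V m (E.mapMatrix A + c • A) := by
    intro A
    ext1 α β
    exact hE (A α β)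
  rw [diffRule_apply, diffRule_apply, map_zsmul]
  congr 1
  induction j generalizing A with
  | zero => simp
  | succ j ih =>
    rw [pow_succ, end_mul_apply, end_mul_apply, ih, hE', ← map_zsmul, ← map_add]
    congr 2
    push_cast
    module

lemma mapMatrix_mul {E : DiffPoly k V →+ DiffPoly k V}
    (hE : ∀ f g, E (f * g) = E f * g + f * E g) (A B : Matrix (Fin m) (Fin m) (DiffPoly k V)) :
    E.mapMatrix (A * B) = E.mapMatrix A * B + A * E.mapMatrix B := by
  ext1 α β
  simp only [AddMonoidHom.mapMatrix_apply, Matrix.map_apply, Matrix.mul_apply, Matrix.add_apply,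
    map_sum, hE, ← Finset.sum_add_distrib]

end Diff

/-! The generic matrix Lax operator -/

section MatrixLax

variable {k : Type*} [Field k] {m d N : ℕ} {I : Set ℤ} {a : Matrix (Fin m) (Fin m) k}
  {b : Module.Basis (Fin d) k (imAd a)}

/-- The generic matrix Lax operator as an element of the operator algebra. -/
abbrev matrixLaxOp (N : ℕ) (I : Set ℤ) (a : Matrix (Fin m) (Fin m) k)
    (b : Module.Basis (Fin d) k (imAd a)) :
    OpAlg (isAssocRule_diffRule (k := k) (V := LaxVar m N d I) (m := m)) :=
  matrixLax N I a b

open Classical in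
lemma matrixLaxOp_orderLE : (matrixLaxOp N I a b).OrderLE N := fun i hi => by
  change (if i = N then _ else if i = (N : ℤ) - 1 then _ else
    if h : i ∈ I ∧ i ≤ (N : ℤ) - 2 then _ else _) = _
  rw [if_neg (by omega), if_neg (by omega), dif_neg (by rintro ⟨-, h⟩; omega)]

lemma matrixLaxOp_coeff_self : (matrixLaxOp N I a b).coeff N = a.map C := if_pos rfl

lemma matrixLaxOp_coeff_sub_one : (matrixLaxOp N I a b).coeff (N - 1) =
    ∑ s : Fin d, (X (Sum.inr s, 0) : DiffPoly k (LaxVar m N d I)) •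
        (b s : Matrix (Fin m) (Fin m) k).map C := by
  change (if (N : ℤ) - 1 = N then _ else if (N : ℤ) - 1 = (N : ℤ) - 1 then _ else _) = _
  rw [if_neg (by omega), if_pos rfl]

open Classical in
lemma matrixLaxOp_coeff_of_mem (i : {i : ℤ // i ∈ I ∧ i ≤ (N : ℤ) - 2}) (α β : Fin m) :
    (matrixLaxOp N I a b).coeff i α β = X (Sum.inl (i, α, β), 0) := by
  have h : (matrixLaxOp N I a b).coeff i =
      Matrix.of fun α β => X (Sum.inl (i, α, β), 0) := by
    change (if (i : ℤ) = N then _ else if (i : ℤ) = (N : ℤ) - 1 then _ else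
      if h : (i : ℤ) ∈ I ∧ (i : ℤ) ≤ (N : ℤ) - 2 then _ else _) = _
    have := i.2.2
    rw [if_neg (by omega), if_neg (by omega), dif_pos i.2]
  rw [h]
  rfl

open Classical in
lemma matrixLaxOp_coeff_of_notMem {i : ℤ} (h1 : i ≠ N) (h2 : i ≠ N - 1) (h3 : i ∉ I) :
    (matrixLaxOp N I a b).coeff i = 0 := by
  change (if i = N then _ else if i = (N : ℤ) - 1 then _ else
    if h : i ∈ I ∧ i ≤ (N : ℤ) - 2 then _ else _) = _
  rw [if_neg h1, if_neg h2, dif_neg fun h => h3 h.1]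

/-- The extension of a linear functional on constant matrices to matrices of polynomials. -/
def extendFunctional {σ : Type*} (l : Matrix (Fin m) (Fin m) k →ₗ[k] k)
    (A : Matrix (Fin m) (Fin m) (MvPolynomial σ k)) : MvPolynomial σ k :=
  ∑ α, ∑ β, C (l (Matrix.single α β 1)) * A α β

lemma functional_eq_sum (l : Matrix (Fin m) (Fin m) k →ₗ[k] k) (A : Matrix (Fin m) (Fin m) k) :
    l A = ∑ α, ∑ β, l (Matrix.single α β 1) * A α β := by
  conv_lhs => rw [Matrix.matrix_eq_sum_single A]
  simp only [map_sum]
  refine Finset.sum_congr rfl fun α _ => Finset.sum_congr rfl fun β _ => ?_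
  rw [mul_comm, ← smul_eq_mul, ← map_smul, Matrix.smul_single, smul_eq_mul, mul_one]

lemma coeff_extendFunctional {σ : Type*} (l : Matrix (Fin m) (Fin m) k →ₗ[k] k)
    (A : Matrix (Fin m) (Fin m) (MvPolynomial σ k)) (s : σ →₀ ℕ) :
    coeff s (extendFunctional l A) = l (A.map (coeff s)) := by
  rw [functional_eq_sum]
  simp only [extendFunctional, coeff_sum, coeff_C_mul, Matrix.map_apply]

/-- The coordinate functionals are extended to all matrices, in any way, so that they can be written
through matrix entries and applied to matrices of polynomials. -/
lemma exists_dual (b : Module.Basis (Fin d) k (imAd a)) :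
    ∃ l : Fin d → Matrix (Fin m) (Fin m) k →ₗ[k] k,
      ∀ A ∈ imAd a, A = ∑ s, l s A • (b s : Matrix (Fin m) (Fin m) k) := by
  choose l hl using fun s => LinearMap.exists_extend (b.coord s)
  refine ⟨l, fun A hA => ?_⟩
  have h1 : ∀ s, l s A = b.repr ⟨A, hA⟩ s := fun s =>
    congrArg (fun g => g ⟨A, hA⟩) (hl s)
  have h2 := congrArg (Subtype.val) (b.sum_repr ⟨A, hA⟩)
  simp only [h1]
  refine h2.symm.trans ?_
  rw [Submodule.coe_sum]
  rfl

/-- A family of functionals giving the coordinates of elements of `Im ad a`. -/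
def dual (b : Module.Basis (Fin d) k (imAd a)) : Fin d → Matrix (Fin m) (Fin m) k →ₗ[k] k :=
  (exists_dual b).choose

lemma eq_sum_dual {A : Matrix (Fin m) (Fin m) k} (hA : A ∈ imAd a) :
    A = ∑ s, dual b s A • (b s : Matrix (Fin m) (Fin m) k) :=
  (exists_dual b).choose_spec A hA

lemma dual_apply_basis (s t : Fin d) :
    dual b s (b t : Matrix (Fin m) (Fin m) k) = if s = t then 1 else 0 := by
  have h := eq_sum_dual (b := b) (b t).2
  have h' : b t = ∑ s, dual b s (b t : Matrix (Fin m) (Fin m) k) • b s := by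
    apply Subtype.ext
    rw [h]
    simp [← h]
  have h2 := congrArg (fun x => b.repr x s) h'
  simp only [Module.Basis.repr_self, map_sum, map_smul, Finsupp.coe_finsetSum, Finset.sum_apply,
    Finsupp.smul_apply, Finsupp.single_apply, smul_eq_mul, mul_ite, mul_one, mul_zero,
    Finset.sum_ite_eq', Finset.mem_univ, if_true] at h2
  rw [← h2]
  simp only [eq_comm]

lemma eq_sum_extendFunctional {σ : Type*} {A : Matrix (Fin m) (Fin m) (MvPolynomial σ k)}
    (hA : ∀ s, A.map (coeff s) ∈ imAd a) :
    A = ∑ s, extendFunctional (dual b s) A • (b s : Matrix (Fin m) (Fin m) k).map C := by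
  ext α β t
  have h := congrArg (fun B => B α β) (eq_sum_dual (b := b) (hA t))
  simp only [Matrix.map_apply, Matrix.sum_apply, Matrix.smul_apply, smul_eq_mul] at h ⊢
  rw [h, coeff_sum]
  refine Finset.sum_congr rfl fun s _ => ?_
  rw [mul_comm (extendFunctional _ _), coeff_C_mul, coeff_extendFunctional, mul_comm]

/-- The coordinate variables are `k`-linear combinations of the entries of $u_{N-1}$, so a flow is
determined on them by its values on $L$. -/
lemma X_inr_eq_extendFunctional (s : Fin d) :
    (X (Sum.inr s, 0) : DiffPoly k (LaxVar m N d I)) =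
      extendFunctional (dual b s) ((matrixLaxOp N I a b).coeff (N - 1)) := by
  rw [matrixLaxOp_coeff_sub_one]
  ext t
  rw [coeff_extendFunctional]
  have h : (∑ s : Fin d, (X (Sum.inr s, 0) : DiffPoly k (LaxVar m N d I)) •
      (b s : Matrix (Fin m) (Fin m) k).map C).map (coeff t) =
      ∑ s' : Fin d, coeff t (X (Sum.inr s', 0) : DiffPoly k (LaxVar m N d I)) •
        (b s' : Matrix (Fin m) (Fin m) k) := by
    ext1 α β
    simp only [Matrix.map_apply, Matrix.sum_apply, Matrix.smul_apply, smul_eq_mul, coeff_sum,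
      mul_comm _ (C _), coeff_C_mul]
    exact Finset.sum_congr rfl fun _ _ => mul_comm _ _
  rw [h, map_sum]
  simp [dual_apply_basis]

/-- The entries of the coefficients of `L` generate the ring of differential polynomials. -/
lemma matrixLax_induction {p : DiffPoly k (LaxVar m N d I) → Prop} (hC : ∀ c, p (C c))
    (hadd : ∀ f g, p f → p g → p (f + g)) (hmul : ∀ f g, p f → p g → p (f * g))
    (hderiv : ∀ f, p f → p (totalDeriv k _ f))
    (hL : ∀ i α β, p ((matrixLaxOp N I a b).coeff i α β)) (f : DiffPoly k (LaxVar m N d I)) :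
    p f := by
  have h0 : p 0 := by simpa using hC 0
  refine diffPoly_induction hC hadd hmul hderiv ?_ f
  rintro (⟨i, α, β⟩ | s)
  · rw [← matrixLaxOp_coeff_of_mem (a := a) (b := b)]
    exact hL _ _ _
  · rw [X_inr_eq_extendFunctional (a := a) (b := b)]
    exact Finset.sum_induction _ p hadd h0 fun α _ =>
      Finset.sum_induction _ p hadd h0 fun β _ => hmul _ _ (hC _) (hL _ _ _)

/-- For diagonalizable `a`, the kernel and the image of `ad a` intersect trivially. -/
lemma comm_eq_zero_of_comm_comm_eq_zero {A : Type*} [CommRing A] [IsDomain A] [Algebra k A]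
    (ha : IsDiagonalizable a) {y : Matrix (Fin m) (Fin m) A}
    (h : a.map (algebraMap k A) * (a.map (algebraMap k A) * y - y * a.map (algebraMap k A)) -
      (a.map (algebraMap k A) * y - y * a.map (algebraMap k A)) * a.map (algebraMap k A) = 0) :
    a.map (algebraMap k A) * y - y * a.map (algebraMap k A) = 0 := by
  obtain ⟨S, c, hS⟩ := ha
  let T : (Matrix (Fin m) (Fin m) A)ˣ := Units.map (algebraMap k A).mapMatrix.toMonoidHom S
  let Δ : Matrix (Fin m) (Fin m) A := Matrix.diagonal fun α => algebraMap k A (c α)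
  have hmap : a.map (algebraMap k A) = T * Δ * (T⁻¹ : (Matrix (Fin m) (Fin m) A)ˣ) := by
    have := congrArg (algebraMap k A).mapMatrix hS
    rw [map_mul, map_mul] at this
    refine this.trans ?_
    congr 2
    ext1 α β
    simp [Δ, Matrix.diagonal_apply, apply_ite (algebraMap k A)]
  rw [hmap] at h ⊢
  let y' : Matrix (Fin m) (Fin m) A := (T⁻¹ : (Matrix (Fin m) (Fin m) A)ˣ) * y * T
  have hy : y = T * y' * (T⁻¹ : (Matrix (Fin m) (Fin m) A)ˣ) := by
    simp only [y', mul_assoc, Units.mul_inv, mul_one, Units.mul_inv_cancel_left]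
  have hconj : ∀ B B' : Matrix (Fin m) (Fin m) A,
      (T * B * (T⁻¹ : (Matrix (Fin m) (Fin m) A)ˣ)) * (T * B' * (T⁻¹ : (Matrix (Fin m) (Fin m) A)ˣ))
        = T * (B * B') * (T⁻¹ : (Matrix (Fin m) (Fin m) A)ˣ) := by
    intro B B'
    simp only [mul_assoc, Units.inv_mul_cancel_left]
  rw [hy] at h ⊢
  simp only [hconj, ← mul_sub, ← sub_mul] at h ⊢
  rw [Units.mul_left_eq_zero, Units.mul_right_eq_zero] at h ⊢
  ext1 α β
  have h1 := congrArg (fun B => B α β) h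
  simp only [Δ, Matrix.sub_apply, Matrix.diagonal_mul, Matrix.mul_diagonal, Matrix.zero_apply]
    at h1 ⊢
  -- In an eigenbasis $\operatorname{ad}a$ multiplies the entry $(\alpha,\beta)$ by
  -- $c_\alpha-c_\beta$; in a domain, if its square kills an entry, so does $\operatorname{ad}a$.
  have h2 : (algebraMap k A (c α) - algebraMap k A (c β)) *
      (algebraMap k A (c α) * y' α β - y' α β * algebraMap k A (c β)) = 0 := by
    rw [← h1]
    ring
  rcases mul_eq_zero.mp h2 with h3 | h3
  · rw [sub_eq_zero.mp h3]
    ring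
  · exact h3

lemma exists_coeff_sub_one_eq_comm : ∃ w, (matrixLaxOp N I a b).coeff (N - 1) =
    a.map C * w - w * a.map C := by
  choose x hx using fun s => (b s).2
  refine ⟨∑ s : Fin d, (X (Sum.inr s, 0) : DiffPoly k (LaxVar m N d I)) • (x s).map C, ?_⟩
  rw [matrixLaxOp_coeff_sub_one, Finset.mul_sum, Finset.sum_mul, ← Finset.sum_sub_distrib]
  refine Finset.sum_congr rfl fun s _ => ?_
  rw [mul_smul_comm, smul_mul_assoc, ← smul_sub]
  congr 1
  rw [← hx]
  simp only [LinearMap.sub_apply, LinearMap.mulLeft_apply, LinearMap.mulRight_apply]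
  exact (map_sub (C : k →+* DiffPoly k (LaxVar m N d I)).mapMatrix _ _).trans
    (by rw [map_mul, map_mul]; rfl)

/-- An element of the centralizer of `L` that vanishes at `u = 0` is zero. -/
lemma matrixLaxOp_eq_zero [CharZero k] (hN : 1 ≤ N) (ha : IsUnit a)
    (had : IsDiagonalizable a)
    {Q : OpAlg (isAssocRule_diffRule (k := k) (V := LaxVar m N d I) (m := m))}
    (hQ : Q * matrixLaxOp N I a b = matrixLaxOp N I a b * Q)
    (h : ∀ i, matEval k _ m (Q.coeff i) = 0) : Q = 0 := by
  by_contra hne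
  obtain ⟨n, hn, hn0⟩ := OpAlg.exists_leading hne
  have t1 := OpAlg.coeff_mul_top hn (matrixLaxOp_orderLE (N := N) (I := I) (a := a) (b := b))
  have t2 := OpAlg.coeff_mul_top (matrixLaxOp_orderLE (N := N) (I := I) (a := a) (b := b)) hn
  rw [hQ, add_comm, t2, matrixLaxOp_coeff_self, diffRule_zero, diffRule_zero] at t1
  have s1 := OpAlg.coeff_mul_subtop hn (matrixLaxOp_orderLE (N := N) (I := I) (a := a) (b := b))
  have s2 := OpAlg.coeff_mul_subtop (matrixLaxOp_orderLE (N := N) (I := I) (a := a) (b := b)) hn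
  obtain ⟨w, hw⟩ := exists_coeff_sub_one_eq_comm (N := N) (I := I) (a := a) (b := b)
  rw [hQ, add_comm n, s2, matrixLaxOp_coeff_self, diffRule_zero, diffRule_zero, diffRule_zero,
    diffRule_zero, diffRule_one, diffRule_one, matDeriv_map_C, smul_zero, mul_zero, hw] at s1
  set A : Matrix (Fin m) (Fin m) (DiffPoly k (LaxVar m N d I)) := a.map C with hA
  set q := Q.coeff n with hq
  set q' := Q.coeff (n - 1)
  have hcomm : A * matDeriv k _ m q = matDeriv k _ m q * A := by
    have := congrArg (matDeriv k _ m) t1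
    rwa [matDeriv_mul, matDeriv_mul, hA, matDeriv_map_C, zero_mul, mul_zero, zero_add, add_zero]
      at this
  -- The subleading coefficient of $[Q,L]=0$, with $u_{N-1}=[A,w]$. Since $[A,q]=0$, one has
  -- $[q,[A,w]]=[A,[q,w]]$, so $NA\,\partial q$ lies in the image of $\operatorname{ad}A$. Here `q'`
  -- is the next coefficient of $Q$, not a derivative.
  have e1 : A * ((N : ℤ) • matDeriv k _ m q) =
      A * (q * w - w * q - q') - (q * w - w * q - q') * A := by
    have e2 : A * ((N : ℤ) • matDeriv k _ m q) =
        q * (A * w - w * A) + 0 + q' * A - A * q' - (A * w - w * A) * q := by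
      rw [← s1]
      abel
    rw [e2]
    have e3 : q * (A * w) = A * (q * w) := by rw [← mul_assoc, ← t1, mul_assoc]
    have e4 : w * A * q = w * q * A := by rw [mul_assoc, t1, mul_assoc]
    simp only [mul_sub, sub_mul, e3, e4, mul_assoc]
    abel
  -- $A\,\partial q$ also commutes with $A$, as differentiating $Aq=qA$ shows.
  have e5 : A * (A * (q * w - w * q - q') - (q * w - w * q - q') * A) -
      (A * (q * w - w * q - q') - (q * w - w * q - q') * A) * A = 0 := by
    rw [← e1, mul_smul_comm, mul_smul_comm, smul_mul_assoc, mul_assoc, ← hcomm, sub_self]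
  have e6 := comm_eq_zero_of_comm_comm_eq_zero had e5
  change A * (q * w - w * q - q') - (q * w - w * q - q') * A = 0 at e6
  rw [← e1] at e6
  have hu : IsUnit A := ha.map (C : k →+* DiffPoly k (LaxVar m N d I)).mapMatrix
  rw [hu.mul_right_eq_zero] at e6
  refine hn0 ?_
  ext1 α β
  have e7 : (N : ℤ) • totalDeriv k _ (q α β) = 0 := congrArg (fun B => B α β) e6
  rw [← Int.cast_smul_eq_zsmul k, smul_eq_zero, Int.cast_natCast, Nat.cast_eq_zero] at e7
  have e8 := eq_C_of_totalDeriv_eq_zero (e7.resolve_left (by omega))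
  have e9 : constantCoeff (q α β) = 0 := congrArg (fun B => B α β) (h n)
  change q α β = 0
  rw [e8, e9, C_0]

/-- The weight of the dependent variables. -/
def laxWeight {m N d : ℕ} {I : Set ℤ} : LaxVar m N d I → ℤ :=
  Sum.elim (fun i => N - i.1) fun _ => 1

/-- The weight derivation. -/
def weightDeriv (k : Type*) [Field k] (m N d : ℕ) (I : Set ℤ) :
    Derivation k (DiffPoly k (LaxVar m N d I)) (DiffPoly k (LaxVar m N d I)) :=
  mkDerivation k fun p => (laxWeight p.1 + p.2) • X p

lemma weightDeriv_X (v : LaxVar m N d I) (j : ℕ) :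
    weightDeriv k m N d I (X (v, j)) = (laxWeight v + j) • X (v, j) := mkDerivation_X _ _ _

lemma weightDeriv_totalDeriv (f : DiffPoly k (LaxVar m N d I)) :
    weightDeriv k m N d I (totalDeriv k _ f) =
      totalDeriv k _ (weightDeriv k m N d I f + (1 : ℤ) • f) := by
  have h : ⁅weightDeriv k m N d I, totalDeriv k (LaxVar m N d I)⁆ = totalDeriv k _ := by
    apply derivation_ext
    rintro ⟨v, j⟩
    rw [Derivation.commutator_apply, totalDeriv_X, weightDeriv_X, weightDeriv_X, map_zsmul,
      totalDeriv_X]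
    push_cast
    module
  have h1 := congrArg (fun Y => Y f) h
  simp only [Derivation.commutator_apply] at h1
  rw [one_smul, map_add]
  exact sub_eq_iff_eq_add'.mp h1

/-- Each $u_i$ has weight $N-i$ and $\partial^i$ has weight $i$, so every term of $L$ has weight
$N$. -/
lemma matrixLaxOp_mapCoeff_weightDeriv : (matrixLaxOp N I a b).mapCoeff
    (AddMonoidHom.mapMatrix (weightDeriv k m N d I : _ →+ _)) 1 =
      (N : ℤ) • matrixLaxOp N I a b := by
  ext1 i
  rw [OpAlg.coeff_mapCoeff, OpAlg.coeff_zsmul, one_mul]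
  ext1 α β
  change weightDeriv k m N d I ((matrixLaxOp N I a b).coeff i α β) +
    i • (matrixLaxOp N I a b).coeff i α β = (N : ℤ) • (matrixLaxOp N I a b).coeff i α β
  by_cases h1 : i = N
  · rw [h1, matrixLaxOp_coeff_self, Matrix.map_apply, derivation_C, zero_add]
  by_cases h2 : i = N - 1
  · rw [h2, matrixLaxOp_coeff_sub_one]
    simp only [Matrix.sum_apply, Matrix.smul_apply, Matrix.map_apply, smul_eq_mul, map_sum,
      Finset.smul_sum, ← Finset.sum_add_distrib, Derivation.leibniz, derivation_C, weightDeriv_X,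
      laxWeight, Sum.elim_inr]
    refine Finset.sum_congr rfl fun s _ => ?_
    rw [mul_zero, zero_add, Nat.cast_zero, add_zero, one_smul, mul_comm]
    module
  by_cases h3 : i ∈ I
  · by_cases h4 : i ≤ (N : ℤ) - 2
    · rw [matrixLaxOp_coeff_of_mem ⟨i, h3, h4⟩, weightDeriv_X, laxWeight, Sum.elim_inl]
      push_cast
      module
    · rw [show (matrixLaxOp N I a b).coeff i = 0 from matrixLaxOp_orderLE i (by omega)]
      simp
  · rw [matrixLaxOp_coeff_of_notMem h1 h2 h3]
    simp

/-- Unlike the scalar case, the values at $u=0$ are matrices, and their commutation has to be drawn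
from the weight grading. -/
lemma isLaxSystem_matrixLaxOp [CharZero k] (hN : 1 ≤ N) (ha : IsUnit a)
    (had : IsDiagonalizable a) : IsLaxSystem (matrixLaxOp N I a b) (matEval k _ m) where
  rule_eq_zero := diffRule_eq_zero
  eval_rule_zero := matEval_diffRule_zero
  eval_rule_succ := matEval_diffRule_succ
  eq_zero _ hQ h := matrixLaxOp_eq_zero hN ha had hQ h
  commute P Q hP hQ i j := by
    refine OpAlg.IsCentral.map_coeff_commute k (matEval k _ m) matEval_diffRule_zero
      matEval_diffRule_succ (mapMatrix_mul fun f g => ?_)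
      (mapMatrix_diffRule weightDeriv_totalDeriv) (fun A => ?_)
      matrixLaxOp_mapCoeff_weightDeriv hP hQ i j
    · change weightDeriv k m N d I _ = weightDeriv k m N d I _ * _ + _ * weightDeriv k m N d I _
      rw [Derivation.leibniz, smul_eq_mul, smul_eq_mul]
      ring
    · ext1 α β
      exact constantCoeff_derivation (Y := weightDeriv k m N d I)
        (fun ⟨v, j⟩ => by rw [weightDeriv_X, map_zsmul, constantCoeff_X, smul_zero]) _

end MatrixLax

/-! Extended matrix Lax flows -/

section MatrixFlow

variable {k V : Type*} [Field k] {m : ℕ}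

lemma diffIncl_X (v : V) (j : ℕ) : diffIncl k V m (X (v, j)) = X (Sum.inl v, j) := by
  simp [diffIncl]

lemma diffIncl_C (c : k) : diffIncl k V m (C c) = C c := rename_C _ _

lemma diffIncl_totalDeriv (f : DiffPoly k V) :
    diffIncl k V m (totalDeriv k V f) = totalDeriv k (V ⊕ Fin m) (diffIncl k V m f) := by
  induction f using MvPolynomial.induction_on with
  | C c => simp only [diffIncl_C, derivation_C, map_zero]
  | add f g hf hg => simp only [map_add, hf, hg]
  | mul_X f p hf =>
    obtain ⟨v, j⟩ := p
    simp only [map_mul, Derivation.leibniz, map_add, smul_eq_mul, hf, totalDeriv_X, diffIncl_X]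

/-- The projection `φ ↦ 0`. -/
def diffProj (k V : Type*) [Field k] (m : ℕ) : DiffPoly k (V ⊕ Fin m) →ₐ[k] DiffPoly k V :=
  aeval fun p => Sum.elim (fun v => X (v, p.2)) (fun _ => 0) p.1

lemma diffProj_diffIncl (f : DiffPoly k V) : diffProj k V m (diffIncl k V m f) = f := by
  suffices h : (diffProj k V m).comp (diffIncl k V m) = AlgHom.id k _ from
    congrArg (fun g => g f) h
  apply algHom_ext
  rintro ⟨v, j⟩
  simp [diffProj, diffIncl]

lemma diffProj_X_inl (v : V) (j : ℕ) : diffProj k V m (X (Sum.inl v, j)) = X (v, j) := by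
  simp [diffProj]

lemma diffProj_X_inr (α : Fin m) (j : ℕ) : diffProj k V m (X (Sum.inr α, j)) = 0 := by
  simp [diffProj]

lemma diffProj_totalDeriv (f : DiffPoly k (V ⊕ Fin m)) :
    diffProj k V m (totalDeriv k (V ⊕ Fin m) f) = totalDeriv k V (diffProj k V m f) := by
  induction f using MvPolynomial.induction_on with
  | C c => rw [derivation_C, map_zero, ← algebraMap_eq, AlgHom.commutes, algebraMap_eq,
      derivation_C]
  | add f g hf hg => simp only [map_add, hf, hg]
  | mul_X f p hf =>
    obtain ⟨v | v, j⟩ := p <;>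
    simp only [Derivation.leibniz, smul_eq_mul, map_add, map_mul, hf, totalDeriv_X, diffProj_X_inl,
      diffProj_X_inr, zero_mul, mul_zero, map_zero, add_zero]

/-- The restriction of a derivation to the polynomials in `u`. -/
def diffRestrict (Y : Derivation k (DiffPoly k (V ⊕ Fin m)) (DiffPoly k (V ⊕ Fin m))) :
    DiffPoly k V →+ DiffPoly k V :=
  ((diffProj k V m : DiffPoly k (V ⊕ Fin m) →+ DiffPoly k V).comp
    (Y : DiffPoly k (V ⊕ Fin m) →+ DiffPoly k (V ⊕ Fin m))).comp
      (diffIncl k V m : DiffPoly k V →+ DiffPoly k (V ⊕ Fin m))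

lemma diffRestrict_apply (Y : Derivation k (DiffPoly k (V ⊕ Fin m)) (DiffPoly k (V ⊕ Fin m)))
    (f : DiffPoly k V) : diffRestrict Y f = diffProj k V m (Y (diffIncl k V m f)) := rfl

lemma diffRestrict_C (Y : Derivation k (DiffPoly k (V ⊕ Fin m)) (DiffPoly k (V ⊕ Fin m)))
    (c : k) : diffRestrict Y (C c) = 0 := by
  rw [diffRestrict_apply, diffIncl_C, derivation_C, map_zero]

lemma diffRestrict_mul (Y : Derivation k (DiffPoly k (V ⊕ Fin m)) (DiffPoly k (V ⊕ Fin m)))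
    (f g : DiffPoly k V) :
    diffRestrict Y (f * g) = diffRestrict Y f * g + f * diffRestrict Y g := by
  simp only [diffRestrict_apply, map_mul, Derivation.leibniz, smul_eq_mul, map_add,
    diffProj_diffIncl]
  ring

section General

variable {L P : OpAlg (isAssocRule_diffRule (k := k) (V := V) (m := m))}
  {Y : Derivation k (DiffPoly k (V ⊕ Fin m)) (DiffPoly k (V ⊕ Fin m))}

lemma IsExtMatrixLaxFlow.restrict_totalDeriv (hY : IsExtMatrixLaxFlow L P Y) (f : DiffPoly k V) :
    diffRestrict Y (totalDeriv k V f) = totalDeriv k V (diffRestrict Y f) := by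
  rw [diffRestrict_apply, diffIncl_totalDeriv, hY.evolution, diffProj_totalDeriv]
  rfl

lemma IsExtMatrixLaxFlow.restrict_coeff (hY : IsExtMatrixLaxFlow L P Y) (i : ℤ) (α β : Fin m) :
    diffRestrict Y (L.coeff i α β) = (P.plus * L - L * P.plus).coeff i α β := by
  rw [diffRestrict_apply, OpAlg.coeff, hY.lax, diffProj_diffIncl]
  rfl

lemma IsExtMatrixLaxFlow.isLaxFlow (hY : IsExtMatrixLaxFlow L P Y) :
    IsLaxFlow L P (diffRestrict Y).mapMatrix where
  leibniz := mapMatrix_mul (diffRestrict_mul Y)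
  rule i j x := by
    rw [mapMatrix_diffRule (c := 0) (fun f => by
      rw [hY.restrict_totalDeriv, zero_smul, add_zero]), zero_mul, zero_smul, add_zero]
  lax := by
    ext1 i
    rw [OpAlg.coeff_mapCoeff_zero]
    ext1 α β
    exact hY.restrict_coeff i α β

end General

/-- Multiplication of vectors of polynomials in `u` and `φ` by matrices of polynomials in `u`. -/
def diffMulHom (k V : Type*) [Field k] (m : ℕ) :
    Matrix (Fin m) (Fin m) (DiffPoly k V) →+* AddMonoid.End (Fin m → DiffPoly k (V ⊕ Fin m)) where
  toFun A := (Matrix.mulVecLin (A.map (diffIncl k V m))).toAddMonoidHom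
  map_one' := by
    ext1 v
    change ((1 : Matrix (Fin m) (Fin m) (DiffPoly k V)).map (diffIncl k V m)).mulVec v = v
    rw [Matrix.map_one _ (map_zero _) (map_one _), Matrix.one_mulVec]
  map_mul' A B := by
    ext1 v
    change ((A * B).map (diffIncl k V m)).mulVec v =
      (A.map (diffIncl k V m)).mulVec ((B.map (diffIncl k V m)).mulVec v)
    rw [Matrix.map_mul, Matrix.mulVec_mulVec]
  map_zero' := by
    ext1 v
    change ((0 : Matrix (Fin m) (Fin m) (DiffPoly k V)).map (diffIncl k V m)).mulVec v = 0
    rw [Matrix.map_zero _ (map_zero _), Matrix.zero_mulVec]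
  map_add' A B := by
    ext1 v
    change ((A + B).map (diffIncl k V m)).mulVec v =
      (A.map (diffIncl k V m)).mulVec v + (B.map (diffIncl k V m)).mulVec v
    rw [Matrix.map_add _ (map_add _), Matrix.add_mulVec]

lemma diffMulHom_apply (A : Matrix (Fin m) (Fin m) (DiffPoly k V))
    (v : Fin m → DiffPoly k (V ⊕ Fin m)) (α : Fin m) :
    diffMulHom k V m A v α = ∑ β, diffIncl k V m (A α β) * v β := rfl

/-- The componentwise action of an additive map on vectors. -/
def vecMap (m : ℕ) {A : Type*} [AddCommGroup A] (f : A →+ A) : (Fin m → A) →+ (Fin m → A) :=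
  AddMonoidHom.compLeft f (Fin m)

lemma vecMap_apply {A : Type*} [AddCommGroup A] (f : A →+ A) (v : Fin m → A) (α : Fin m) :
    vecMap m f v α = f (v α) := rfl

/-- The derivation `∂` of vectors of polynomials in `u` and `φ`. -/
def vecDeriv (k V : Type*) [Field k] (m : ℕ) : AddMonoid.End (Fin m → DiffPoly k (V ⊕ Fin m)) :=
  vecMap m (totalDeriv k (V ⊕ Fin m) : DiffPoly k (V ⊕ Fin m) →+ DiffPoly k (V ⊕ Fin m))

lemma vecDeriv_apply (v : Fin m → DiffPoly k (V ⊕ Fin m)) (α : Fin m) :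
    vecDeriv k V m v α = totalDeriv k (V ⊕ Fin m) (v α) := rfl

/-- The vector `φ`. -/
def phi (k V : Type*) [Field k] (m : ℕ) : Fin m → DiffPoly k (V ⊕ Fin m) :=
  fun α => X (Sum.inr α, 0)

lemma vecDeriv_pow_phi (i : ℕ) (α : Fin m) :
    (vecDeriv k V m ^ i) (phi k V m) α = X (Sum.inr α, i) := by
  induction i with
  | zero => rfl
  | succ i ih =>
    rw [pow_succ', end_mul_apply, vecDeriv_apply, ih]
    exact totalDeriv_X _ _

lemma diffApply_eq_act (A : OpAlg (isAssocRule_diffRule (k := k) (V := V) (m := m))) :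
    diffApply A = A.act (diffMulHom k V m) (fun i => vecDeriv k V m ^ i) (phi k V m) := by
  obtain ⟨K, hA⟩ := A.exists_orderLE_nat
  funext α
  rw [OpAlg.act_eq_sum _ _ hA, Finset.sum_apply]
  change ∑ᶠ i : ℕ, ∑ β : Fin m, diffIncl k V m (A.coeff i α β) * X (Sum.inr β, i) = _
  rw [finsum_eq_sum_of_support_subset (s := Finset.range K)]
  · refine Finset.sum_congr rfl fun i _ => ?_
    rw [diffMulHom_apply]
    simp only [vecDeriv_pow_phi]
  · intro i hi
    rw [Finset.coe_range, Set.mem_Iio]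
    by_contra h
    refine hi (Finset.sum_eq_zero fun β _ => ?_)
    have h0 : A.coeff i = 0 := hA i (by omega)
    exact (congrArg (fun B => diffIncl k V m (B α β) * X (Sum.inr β, i)) h0).trans
      (by rw [Matrix.zero_apply, map_zero, zero_mul])

/-- `vecMap` of a derivation. -/
abbrev vecDer (Y : Derivation k (DiffPoly k (V ⊕ Fin m)) (DiffPoly k (V ⊕ Fin m))) :
    (Fin m → DiffPoly k (V ⊕ Fin m)) →+ (Fin m → DiffPoly k (V ⊕ Fin m)) :=
  vecMap m (Y : DiffPoly k (V ⊕ Fin m) →+ DiffPoly k (V ⊕ Fin m))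

lemma vecDeriv_diffMulHom (A : Matrix (Fin m) (Fin m) (DiffPoly k V))
    (v : Fin m → DiffPoly k (V ⊕ Fin m)) :
    vecDeriv k V m (diffMulHom k V m A v) =
      diffMulHom k V m (matDeriv k V m A) v + diffMulHom k V m A (vecDeriv k V m v) := by
  funext α
  rw [Pi.add_apply, vecDeriv_apply]
  simp only [diffMulHom_apply, vecDeriv_apply, matDeriv_apply, ← Finset.sum_add_distrib,
    diffIncl_totalDeriv]
  refine (map_sum (totalDeriv k (V ⊕ Fin m)) _ _).trans (Finset.sum_congr rfl fun β _ => ?_)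
  rw [Derivation.leibniz, smul_eq_mul, smul_eq_mul, add_comm, mul_comm (v β)]

/-- For nonnegative exponents the commutation rule is the Leibniz rule for a matrix times a vector;
this supplies the module hypothesis of `IsLaxSystem.flows_commute_act`. -/
lemma vecDeriv_pow_diffMulHom (i l : ℕ) (A : Matrix (Fin m) (Fin m) (DiffPoly k V))
    (v : Fin m → DiffPoly k (V ⊕ Fin m)) :
    (vecDeriv k V m ^ i) (diffMulHom k V m A ((vecDeriv k V m ^ l) v)) =
      ∑ j ∈ Finset.range (i + 1),
        diffMulHom k V m (diffRule k V m i j A) ((vecDeriv k V m ^ (i - j + l)) v) := by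
  have h := pow_apply_leibniz (M := Fin m → DiffPoly k (V ⊕ Fin m))
    (AddMonoidHom.mk' (fun A => (diffMulHom k V m A : (Fin m → DiffPoly k (V ⊕ Fin m)) →+
      (Fin m → DiffPoly k (V ⊕ Fin m)))) (map_add (diffMulHom k V m)))
    (matDeriv k V m) (vecDeriv k V m) vecDeriv_diffMulHom i A ((vecDeriv k V m ^ l) v)
  refine h.trans ?_
  rw [Finset.Nat.sum_antidiagonal_eq_sum_range_succ_mk]
  refine Finset.sum_congr rfl fun j _ => ?_
  rw [diffRule_apply, Ring.choose_natCast, pow_add, end_mul_apply, Nat.cast_smul_eq_nsmul,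
    map_nsmul]
  rfl

lemma derivation_ext_diff {Y Z : Derivation k (DiffPoly k (V ⊕ Fin m)) (DiffPoly k (V ⊕ Fin m))}
    (hY : ∀ f, Y (totalDeriv k _ f) = totalDeriv k _ (Y f))
    (hZ : ∀ f, Z (totalDeriv k _ f) = totalDeriv k _ (Z f))
    (hu : ∀ f, Y (diffIncl k V m f) = Z (diffIncl k V m f))
    (hφ : ∀ α, Y (phi k V m α) = Z (phi k V m α)) : Y = Z := by
  apply derivation_ext
  rintro ⟨v | α, j⟩
  · rw [← diffIncl_X, hu]
  · induction j with
    | zero => exact hφ α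
    | succ j ih => rw [← totalDeriv_X, hY, hZ, ih]

/-! ### Extended flows of the generic matrix operator -/

variable {d N : ℕ} {I : Set ℤ} {a : Matrix (Fin m) (Fin m) k} {b : Module.Basis (Fin d) k (imAd a)}
  {P Q : OpAlg (isAssocRule_diffRule (k := k) (V := LaxVar m N d I) (m := m))}
  {Y Z : Derivation k (DiffPoly k (LaxVar m N d I ⊕ Fin m)) (DiffPoly k (LaxVar m N d I ⊕ Fin m))}

lemma IsExtMatrixLaxFlow.apply_diffIncl (hY : IsExtMatrixLaxFlow (matrixLaxOp N I a b) P Y)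
    (f : DiffPoly k (LaxVar m N d I)) :
    Y (diffIncl k _ m f) = diffIncl k _ m (diffRestrict Y f) := by
  induction f using matrixLax_induction (a := a) (b := b) with
  | hC c => rw [diffRestrict_C, diffIncl_C, derivation_C, map_zero]
  | hadd f g hf hg => simp only [map_add, hf, hg]
  | hmul f g hf hg =>
    rw [diffRestrict_mul, map_mul, Derivation.leibniz, hf, hg, map_add, map_mul, map_mul,
      smul_eq_mul, smul_eq_mul]
    ring
  | hderiv f hf =>
    rw [diffIncl_totalDeriv, hY.evolution, hf, hY.restrict_totalDeriv, diffIncl_totalDeriv]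
  | hL i α β => exact (hY.lax i α β).trans (congrArg _ (hY.restrict_coeff i α β).symm)

lemma IsExtMatrixLaxFlow.matEval_restrict [CharZero k] (hN : 1 ≤ N) (ha : IsUnit a)
    (had : IsDiagonalizable a)
    (hP : (matrixLaxOp N I a b).IsCentral P) (hY : IsExtMatrixLaxFlow (matrixLaxOp N I a b) P Y)
    (A : Matrix (Fin m) (Fin m) (DiffPoly k (LaxVar m N d I))) :
    matEval k _ m ((diffRestrict Y).mapMatrix A) = 0 := by
  suffices h : ∀ f, constantCoeff (diffRestrict Y f) = 0 by
    ext1 α β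
    exact h _
  intro f
  induction f using matrixLax_induction (a := a) (b := b) with
  | hC c => rw [diffRestrict_C, map_zero]
  | hadd f g hf hg => simp only [map_add, hf, hg, add_zero]
  | hmul f g hf hg =>
    rw [diffRestrict_mul, map_add, map_mul, map_mul, hf, hg, zero_mul, mul_zero, add_zero]
  | hderiv f hf => rw [hY.restrict_totalDeriv, constantCoeff_totalDeriv]
  | hL i α β =>
    rw [hY.restrict_coeff]
    exact congrArg (fun B => B α β)
      ((isLaxSystem_matrixLaxOp hN ha had).eval_comm hP (OpAlg.IsCentral.self _) i)

lemma IsExtMatrixLaxFlow.vecMap_diffMulHom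
    (hY : IsExtMatrixLaxFlow (matrixLaxOp N I a b) P Y)
    (A : Matrix (Fin m) (Fin m) (DiffPoly k (LaxVar m N d I)))
    (v : Fin m → DiffPoly k (LaxVar m N d I ⊕ Fin m)) :
    vecDer Y (diffMulHom k _ m A v) =
      diffMulHom k _ m ((diffRestrict Y).mapMatrix A) v +
        diffMulHom k _ m A (vecDer Y v) := by
  funext α
  rw [Pi.add_apply, vecMap_apply]
  simp only [diffMulHom_apply, vecMap_apply, AddMonoidHom.mapMatrix_apply, Matrix.map_apply,
    ← Finset.sum_add_distrib, ← hY.apply_diffIncl]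
  refine (map_sum Y _ _).trans (Finset.sum_congr rfl fun β _ => ?_)
  rw [Derivation.leibniz, smul_eq_mul, smul_eq_mul, add_comm, mul_comm (v β)]
  rfl

lemma vecMap_vecDeriv_pow {V : Type*}
    {Y : Derivation k (DiffPoly k (V ⊕ Fin m)) (DiffPoly k (V ⊕ Fin m))}
    (hY : ∀ f, Y (totalDeriv k _ f) = totalDeriv k _ (Y f)) (i : ℕ)
    (v : Fin m → DiffPoly k (V ⊕ Fin m)) :
    vecDer Y ((vecDeriv k V m ^ i) v) =
      (vecDeriv k V m ^ i) (vecDer Y v) := by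
  induction i with
  | zero => rfl
  | succ i ih =>
    rw [pow_succ', end_mul_apply, end_mul_apply, ← ih]
    funext α
    exact hY _

/-- The extended matrix Lax flows commute. -/
lemma IsExtMatrixLaxFlow.commute [CharZero k] (hN : 1 ≤ N) (ha : IsUnit a)
    (had : IsDiagonalizable a)
    (hP : (matrixLaxOp N I a b).IsCentral P) (hQ : (matrixLaxOp N I a b).IsCentral Q)
    (hY : IsExtMatrixLaxFlow (matrixLaxOp N I a b) P Y)
    (hZ : IsExtMatrixLaxFlow (matrixLaxOp N I a b) Q Z) : ⁅Y, Z⁆ = 0 := by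
  have hL := isLaxSystem_matrixLaxOp (I := I) (b := b) hN ha had
  have hYc := hY.matEval_restrict hN ha had hP
  have hZc := hZ.matEval_restrict hN ha had hQ
  have hu : ∀ f, diffRestrict Y (diffRestrict Z f) = diffRestrict Z (diffRestrict Y f) := by
    intro f
    induction f using matrixLax_induction (a := a) (b := b) with
    | hC c => simp only [diffRestrict_C, map_zero]
    | hadd f g hf hg => simp only [map_add, hf, hg]
    | hmul f g hf hg =>
      simp only [diffRestrict_mul, map_add, hf, hg]
      ring
    | hderiv f hf => simp only [hY.restrict_totalDeriv, hZ.restrict_totalDeriv, hf]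
    | hL i α β =>
      exact congrArg (fun B => B α β)
        (hL.flows_commute hP hQ hY.isLaxFlow hZ.isLaxFlow hYc hZc i)
  apply derivation_ext_diff
  · intro f
    simp only [Derivation.commutator_apply, hY.evolution, hZ.evolution, map_sub]
  · intro f
    simp
  · intro f
    rw [Derivation.commutator_apply, hZ.apply_diffIncl, hY.apply_diffIncl, hY.apply_diffIncl,
      hZ.apply_diffIncl, hu, sub_self]
    rfl
  · intro α
    rw [Derivation.commutator_apply]
    refine sub_eq_zero.mpr ?_
    have h := hL.flows_commute_act (diffMulHom k _ m) (fun i => vecDeriv k _ m ^ i) hP hQ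
      hY.isLaxFlow hZ.isLaxFlow hYc hZc vecDeriv_pow_diffMulHom
      (Y := vecDer Y) (Z := vecDer Z) hY.vecMap_diffMulHom
      (vecMap_vecDeriv_pow hY.evolution) hZ.vecMap_diffMulHom
      (vecMap_vecDeriv_pow hZ.evolution) (φ := phi k _ m)
      ((funext hY.ext).trans (diffApply_eq_act _)) ((funext hZ.ext).trans (diffApply_eq_act _))
    exact congrFun h α

/-- The coefficient at $N-1$ is present whatever `I` is, so $N\ge1$ is what keeps its exponent
nonnegative. -/
lemma matrixLaxOp_plus (hN : 1 ≤ N) (hI : I = Set.Ici 0) :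
    (matrixLaxOp N I a b).plus = matrixLaxOp N I a b := by
  ext1 i
  rw [OpAlg.coeff_plus]
  split_ifs with h
  · rfl
  · exact (matrixLaxOp_coeff_of_notMem (by omega) (by omega) (by rw [hI]; exact h)).symm

/-- Every element of the center of the centralizer has exactly one extended Lax flow. -/
lemma existsUnique_isExtMatrixLaxFlow (hI : I = Set.Ici 0 ∨ I = Set.univ) (hN : 1 ≤ N)
    (hP : (matrixLaxOp N I a b).IsCentral P) :
    ∃! Y, IsExtMatrixLaxFlow (matrixLaxOp N I a b) P Y := by
  set L := matrixLaxOp N I a b with hL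
  obtain ⟨W, hW⟩ : ∃ W, W = P.plus * L - L * P.plus := ⟨_, rfl⟩
  have hWord : W.OrderLE (N - 1) := hW ▸ OpAlg.comm_plus_orderLE hP.1 matrixLaxOp_orderLE
  -- In the differential case $L=L_+$, so $[P_+,L]$ is a commutator of operators without negative
  -- exponents.
  have hWneg : ∀ i ∉ I, W.coeff i = 0 := by
    intro i hi
    rcases hI with h | h
    · have hi' : i < 0 := by
        rw [h] at hi
        exact not_le.mp hi
      rw [hW, hL, ← matrixLaxOp_plus (a := a) (b := b) hN h, OpAlg.coeff_sub,
        OpAlg.plus_mul_plus_coeff_of_neg diffRule_eq_zero _ _ hi',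
        OpAlg.plus_mul_plus_coeff_of_neg diffRule_eq_zero _ _ hi', sub_zero]
    · rw [h] at hi
      exact absurd (Set.mem_univ i) hi
  -- From $[P_+,L]=[L,P_-]$ the coefficient at $N-1$ is $[u_N,p]$, with $p$ the coefficient of $P_-$
  -- at $-1$. Every monomial of it has its matrix coefficient in
  -- $\operatorname{Im}\operatorname{ad}u_N$, so the coordinates describe it completely.
  have hWtop : W.coeff (N - 1) = ∑ s, extendFunctional (dual b s) (W.coeff (N - 1)) •
      (b s : Matrix (Fin m) (Fin m) k).map C := by
    refine eq_sum_extendFunctional fun t => ?_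
    set p := (P - P.plus).coeff (-1) with hp
    have h1 : W.coeff (N - 1) = a.map C * p - p * a.map C := by
      rw [hW, OpAlg.comm_plus_eq hP.1, OpAlg.coeff_sub, sub_eq_add_neg (N : ℤ) 1,
        OpAlg.coeff_mul_top matrixLaxOp_orderLE P.sub_plus_orderLE, add_comm (N : ℤ),
        OpAlg.coeff_mul_top P.sub_plus_orderLE matrixLaxOp_orderLE, matrixLaxOp_coeff_self,
        diffRule_zero, diffRule_zero]
    refine ⟨p.map (coeff t), ?_⟩
    rw [h1]
    ext1 α β
    simp only [LinearMap.sub_apply, LinearMap.mulLeft_apply, LinearMap.mulRight_apply,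
      Matrix.sub_apply, Matrix.mul_apply, Matrix.map_apply, coeff_sub, coeff_sum, coeff_C_mul]
    congr 1
    refine Finset.sum_congr rfl fun γ _ => ?_
    rw [mul_comm (p α γ), coeff_C_mul, mul_comm]
  let val : LaxVar m N d I ⊕ Fin m → DiffPoly k (LaxVar m N d I ⊕ Fin m) :=
    Sum.elim (fun v => diffIncl k _ m (Sum.elim (fun q => W.coeff q.1 q.2.1 q.2.2)
      (fun s => extendFunctional (dual b s) (W.coeff (N - 1))) v)) (diffApply (FormalOp.plus P))
  let del : Module.End k (DiffPoly k (LaxVar m N d I ⊕ Fin m)) := (totalDeriv k _).toLinearMap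
  let Y : Derivation k (DiffPoly k (LaxVar m N d I ⊕ Fin m))
      (DiffPoly k (LaxVar m N d I ⊕ Fin m)) := mkDerivation k fun p => (del ^ p.2) (val p.1)
  have hYX : ∀ v j, Y (X (v, j)) = (del ^ j) (val v) := fun v s => mkDerivation_X _ _ _
  have hYX0 : ∀ v, Y (X (v, 0)) = val v := fun v => hYX v 0
  have hev : ∀ f, Y (totalDeriv k _ f) = totalDeriv k _ (Y f) := by
    have h : ⁅Y, totalDeriv k (LaxVar m N d I ⊕ Fin m)⁆ = 0 := by
      apply derivation_ext
      rintro ⟨v, j⟩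
      rw [Derivation.commutator_apply, totalDeriv_X, hYX, hYX, pow_succ']
      exact sub_self _
    intro f
    exact sub_eq_zero.mp (congrArg (fun Z => Z f) h)
  have hlax : ∀ i α β, Y (diffIncl k _ m (L.coeff i α β)) = diffIncl k _ m (W.coeff i α β) := by
    intro i α β
    by_cases h1 : i = N
    · rw [show W.coeff i = 0 from hWord i (by omega), h1, hL, matrixLaxOp_coeff_self,
        Matrix.map_apply, diffIncl_C, derivation_C, Matrix.zero_apply, map_zero]
    by_cases h2 : i = N - 1
    · rw [h2, hWtop, hL, matrixLaxOp_coeff_sub_one]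
      simp only [Matrix.sum_apply, Matrix.smul_apply, Matrix.map_apply, smul_eq_mul, map_sum,
        map_mul, diffIncl_C, Derivation.leibniz, derivation_C, diffIncl_X, hYX0]
      refine Finset.sum_congr rfl fun s _ => ?_
      rw [mul_zero, zero_add, mul_comm]
      rfl
    by_cases h3 : i ∈ I
    · by_cases h4 : i ≤ (N : ℤ) - 2
      · rw [hL, matrixLaxOp_coeff_of_mem ⟨i, h3, h4⟩, diffIncl_X, hYX0]
        rfl
      · rw [show W.coeff i = 0 from hWord i (by omega),
          show L.coeff i = 0 from matrixLaxOp_orderLE i (by omega), Matrix.zero_apply, map_zero,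
          map_zero]
    · rw [hWneg i h3, hL, matrixLaxOp_coeff_of_notMem h1 h2 h3, Matrix.zero_apply, map_zero,
        map_zero]
  refine ⟨Y, ⟨hev, fun i α β => ?_, fun α => hYX0 _⟩, fun Z hZ => ?_⟩
  · rw [hW] at hlax
    exact hlax i α β
  · refine derivation_ext_diff hZ.evolution hev (fun f => ?_)
      (fun α => (hZ.ext α).trans (hYX0 (Sum.inr α)).symm)
    induction f using matrixLax_induction (a := a) (b := b) with
    | hC c => rw [diffIncl_C, derivation_C, derivation_C]
    | hadd f g hf hg => simp only [map_add, hf, hg]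
    | hmul f g hf hg => simp only [map_mul, Derivation.leibniz, hf, hg]
    | hderiv f hf => rw [diffIncl_totalDeriv, hZ.evolution, hev, hf]
    | hL i α β =>
      rw [hlax, hW]
      exact hZ.lax i α β

end MatrixFlow

end LaxExt

end

/-- First part: the generic matrix Lax operator, differential (`I = {i | 0 ≤ i}`) or
pseudodifferential (`I` is everything). Second part: the generic scalar difference Lax operator.
In both, every `P` in the center of the centralizer of `L` has exactly one extended Lax flow, and
all of these flows commute. -/
theorem proposition5p14 (k : Type*) [Field k] [CharZero k] (N : ℕ) (hN : 1 ≤ N) :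
    (∀ (I : Set ℤ), (I = Set.Ici 0 ∨ I = Set.univ) →
      ∀ (m d : ℕ) (a : Matrix (Fin m) (Fin m) k), IsUnit a → LaxExt.IsDiagonalizable a →
      ∀ (b : Module.Basis (Fin d) k (LaxExt.imAd a)),
        (∀ P ∈ LaxExt.centerOfCentralizer (LaxExt.diffRule k (LaxExt.LaxVar m N d I) m)
            (LaxExt.matrixLax N I a b),
          ∃! Y, LaxExt.IsExtMatrixLaxFlow (LaxExt.matrixLax N I a b) P Y) ∧
        (∀ P ∈ LaxExt.centerOfCentralizer (LaxExt.diffRule k (LaxExt.LaxVar m N d I) m)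
            (LaxExt.matrixLax N I a b),
          ∀ Q ∈ LaxExt.centerOfCentralizer (LaxExt.diffRule k (LaxExt.LaxVar m N d I) m)
            (LaxExt.matrixLax N I a b),
          ∀ Y Z, LaxExt.IsExtMatrixLaxFlow (LaxExt.matrixLax N I a b) P Y →
            LaxExt.IsExtMatrixLaxFlow (LaxExt.matrixLax N I a b) Q Z → ⁅Y, Z⁆ = 0)) ∧
    ((∀ P ∈ LaxExt.centerOfCentralizer (LaxExt.shiftRule k {i : ℤ // i < N})
          (LaxExt.shiftLax k N),
        ∃! Y, LaxExt.IsExtShiftLaxFlow (LaxExt.shiftLax k N) P Y) ∧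
      (∀ P ∈ LaxExt.centerOfCentralizer (LaxExt.shiftRule k {i : ℤ // i < N})
          (LaxExt.shiftLax k N),
        ∀ Q ∈ LaxExt.centerOfCentralizer (LaxExt.shiftRule k {i : ℤ // i < N})
          (LaxExt.shiftLax k N),
        ∀ Y Z, LaxExt.IsExtShiftLaxFlow (LaxExt.shiftLax k N) P Y →
          LaxExt.IsExtShiftLaxFlow (LaxExt.shiftLax k N) Q Z → ⁅Y, Z⁆ = 0)) := by
  refine ⟨fun I hI m d a ha had b => ⟨fun P hP => ?_, fun P hP Q hQ Y Z hY hZ => ?_⟩,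
    fun P hP => ?_, fun P hP Q hQ Y Z hY hZ => ?_⟩
  · exact LaxExt.existsUnique_isExtMatrixLaxFlow hI hN hP
  · exact LaxExt.IsExtMatrixLaxFlow.commute hN ha had hP hQ hY hZ
  · exact LaxExt.existsUnique_isExtShiftLaxFlow hP
  · exact LaxExt.IsExtShiftLaxFlow.commute hN hP hQ hY hZ
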